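/- Let $H$ be an infinite-dimensional real separable Hilbert space with norm $|\cdot|$ and inner product $\langle\cdot,\cdot\rangle$. For $\theta\in(0,1)$ and a Banach space $E$, let $C_b^\theta(H,E)$ be the space of bounded $\theta$-Hölder continuous maps $g:H\to E$, with norm $\|g\|_{C^\theta}=\|g\|_0+[g]_{C^\theta}$, where $\|g\|_0=\sup_{x}|g(x)|_E$ and $[g]_{C^\theta}=\sup_{x\ne x'}|g(x)-g(x')|_E\,|x-x'|^{-\theta}$; write $C_b^\theta(H)=C_b^\theta(H,\mathbb R)$. Let $C^1_b(H)$ be the space of bounded Fréchet differentiable functions $H\to\mathbb R$ with bounded continuous derivative. Let $A:D(A)\subset H\to H$ be self-adjoint and negative definite (there is $\omega>0$ with $\langle Ax,x\rangle\le-\omega|x|^2$ for all $x\in D(A)$), with $A^{-1}$ of trace class. Let $(e_k)_{k\ge1}$ be an orthonormal basis of $H$ with $Ae_k=-\lambda_ke_k$; then $\lambda_k>0$ and $\sum_k\lambda_k^{-1}<\infty$. The operators $e^{tA}$ and $(-A)^{1/2}$ are diagonal in this basis, with eigenvalues $e^{-\lambda_kt}$ and $\lambda_k^{1/2}$, and $D((-A)^{1/2})=\{x:\sum_k\lambda_k\langle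 x,e_k\rangle^2<\infty\}$. For $t>0$ let $N(0,Q_t)$ be the centred Gaussian measure on $H$ with covariance operator $Q_t=\int_0^te^{2sA}\,ds$, and for $z\in H$ let $\Gamma_tz=\sum_k\lambda_k^{-1/2}(1-e^{-\lambda_kt})\langle z,e_k\rangle e_k$. For bounded continuous $f:H\to\mathbb R$ and $\lambda>0$ put $$P_t^{(z)}f(x)=\int_Hf(e^{tA}x+y+\Gamma_tz)\,N(0,Q_t)(dy),\qquad u^{(z)}(x)=\int_0^\infty e^{-\lambda t}P_t^{(z)}f(x)\,dt,\qquad x\in H.$$ **Theorem.** Let $\theta\in(0,1)$. There exist a function $C_\theta:(0,\infty)\to[0,\infty)$, strictly decreasing, with $\lim_{\lambda\to\infty}C_\theta(\lambda)=0$, and a constant $M_\theta>0$, neither depending on $A$, $(e_k)$, $z$, $f$ (and $M_\theta$ not depending on $\lambda$), such that for all $\lambda>0$ and $z\in H$ the following hold. (i) For every $f\in C_b^\theta(H)$, the integral defining $u^{(z)}(x)$ converges absolutely for every $x\in H$, $u^{(z)}\in C_b^1(H)$, $Du^{(z)}(x)\in D((-A)^{1/2})$ for every $x\in H$, and $(-A)^{1/2}Du^{(z)}\in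 C_b^\theta(H,H)$. Moreover $$\sup_{x\in H}\Big[\sum_{k\ge1}\lambda_k\,(D_{e_k}u^{(z)}(x))^2\Big]^{1/2}=\|(-A)^{1/2}Du^{(z)}\|_0\le C_\theta(\lambda)\,\|f\|_{C^\theta},\qquad[(-A)^{1/2}Du^{(z)}]_{C^\theta}\le M_\theta\,\|f\|_{C^\theta}.$$ (ii) Let $f\in C_b^\theta(H)$ and $(f_n)_{n\ge1}\subset C_b^\theta(H)$ with $\sup_n\|f_n\|_{C^\theta}<\infty$ and $f_n(x)\to f(x)$ for every $x\in H$, and let $u_n^{(z)}(x)=\int_0^\infty e^{-\lambda t}P_t^{(z)}f_n(x)\,dt$. Then, for all $x,h\in H$, $$\langle(-A)^{1/2}Du_n^{(z)}(x),h\rangle\to\langle(-A)^{1/2}Du^{(z)}(x),h\rangle\quad\text{as }n\to\infty.$$ -/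

import Mathlib

open MeasureTheory ProbabilityTheory Filter Set Topology
open scoped NNReal ENNReal

noncomputable section

namespace OrnsteinUhlenbeck

variable {H : Type*} [NormedAddCommGroup H] [InnerProductSpace ℝ H]

section Operators

/-- Trace class (nuclear) operators on a Hilbert space: `T x = ∑ₙ ⟨aₙ, x⟩ bₙ` for all `x`, with
`∑ₙ ‖aₙ‖ ‖bₙ‖ < ∞`. -/
def IsTraceClass (T : H →L[ℝ] H) : Prop :=
  ∃ a b : ℕ → H, Summable (fun n => ‖a n‖ * ‖b n‖) ∧
    ∀ x, HasSum (fun n => inner ℝ (a n) x • b n) (T x)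

/-- `T` is a bounded, everywhere defined inverse of the (unbounded) operator `A`. -/
def IsBoundedInverse (A : H →ₗ.[ℝ] H) (T : H →L[ℝ] H) : Prop :=
  (∀ y : H, ∃ h : T y ∈ A.domain, A ⟨T y, h⟩ = y) ∧ ∀ x : A.domain, T (A x) = x

/-- The standing hypothesis on the unbounded operator `A : D(A) ⊆ H → H`: it is self-adjoint
(in particular densely defined), negative definite, and `A⁻¹` is a trace class operator. -/
structure IsAdmissible [CompleteSpace H] (A : H →ₗ.[ℝ] H) : Prop where
  selfAdjoint : IsSelfAdjoint A
  negDef : ∃ ω : ℝ, 0 < ω ∧ ∀ x : A.domain, inner ℝ (A x) (x : H) ≤ -ω * ‖(x : H)‖ ^ 2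
  traceClassInv : ∃ T : H →L[ℝ] H, IsBoundedInverse A T ∧ IsTraceClass T

/-- `(eₖ)` is an orthonormal basis of eigenvectors of `A`, with `A eₖ = -λₖ eₖ`. -/
def IsEigenbasis (A : H →ₗ.[ℝ] H) (e : HilbertBasis ℕ ℝ H) (lam : ℕ → ℝ) : Prop :=
  ∀ k, ∃ h : e k ∈ A.domain, A ⟨e k, h⟩ = -lam k • e k

theorem IsTraceClass.isCompactOperator [CompleteSpace H] {T : H →L[ℝ] H} (hT : IsTraceClass T) :
    IsCompactOperator T := by
  obtain ⟨a, b, hs, hab⟩ := hT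
  let R : ℕ → H →L[ℝ] H := fun n => (innerSL ℝ (a n)).smulRight (b n)
  have hR : Summable R := by
    refine Summable.of_norm_bounded hs fun n => ?_
    simp [R, ContinuousLinearMap.norm_smulRight_apply]
  have hRT : HasSum R T := by
    have h : (∑' n, R n) = T := by
      ext x
      have h1 := (ContinuousLinearMap.apply ℝ H x).hasSum hR.hasSum
      exact h1.unique (hab x)
    exact h ▸ hR.hasSum
  refine isCompactOperator_of_tendsto hRT (Eventually.of_forall fun s => ?_)
  induction s using Finset.cons_induction with
  | empty => simpa using isCompactOperator_zero
  | cons n s hn ih =>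
    rw [Finset.sum_cons]
    refine IsCompactOperator.add ?_ ih
    have h1 : IsCompactOperator (ContinuousLinearMap.toSpanSingleton ℝ (b n)) := by
      exact ⟨_, (isCompact_closedBall (0:ℝ) 1).image
        (ContinuousLinearMap.toSpanSingleton ℝ (b n)).continuous,
        Filter.mem_of_superset (Metric.closedBall_mem_nhds 0 one_pos)
          (Set.subset_preimage_image _ _)⟩
    exact h1.comp_clm (innerSL ℝ (a n))

/-- Under the standing hypothesis on a separable infinite dimensional space, an orthonormal basis
of eigenvectors exists. -/
theorem IsAdmissible.exists_isEigenbasis [CompleteSpace H] [TopologicalSpace.SeparableSpace H]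
    (hH : ¬ FiniteDimensional ℝ H) {A : H →ₗ.[ℝ] H} (hA : IsAdmissible A) :
    ∃ (e : HilbertBasis ℕ ℝ H) (lam : ℕ → ℝ), IsEigenbasis A e lam := by
  obtain ⟨T, ⟨hT1, hT2⟩, hTt⟩ := hA.traceClassInv
  have hsymA : ∀ x y : A.domain, inner ℝ (A x) (y : H) = inner ℝ (x : H) (A y) := by
    have h := LinearPMap.adjoint_isFormalAdjoint hA.selfAdjoint.dense_domain
    rw [LinearPMap.isSelfAdjoint_def.1 hA.selfAdjoint] at h
    exact h
  have hsym : T.toLinearMap.IsSymmetric := by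
    intro x y
    obtain ⟨hx, hx'⟩ := hT1 x
    obtain ⟨hy, hy'⟩ := hT1 y
    have h := hsymA ⟨T x, hx⟩ ⟨T y, hy⟩
    rw [hx', hy'] at h
    exact h.symm
  have hinj : ∀ x, T x = 0 → x = 0 := by
    intro x hx
    obtain ⟨h, h'⟩ := hT1 x
    rw [← h']
    have : (⟨T x, h⟩ : A.domain) = 0 := Subtype.ext hx
    rw [this, A.map_zero]
  have hbot := ContinuousLinearMap.orthogonalComplement_iSup_eigenspaces_eq_bot
    hTt.isCompactOperator hsym
  have hfam := hsym.orthogonalFamily_eigenspaces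
  have hcl : ∀ μ : ℝ, CompleteSpace (Module.End.eigenspace T.toLinearMap μ) := by
    intro μ
    have hc : IsClosed (Module.End.eigenspace T.toLinearMap μ : Set H) := by
      have : (Module.End.eigenspace T.toLinearMap μ : Set H) = {x | T x = μ • x} := by
        ext x
        simp
      rw [this]
      exact isClosed_eq T.continuous (continuous_const_smul μ)
    exact hc.completeSpace_coe
  choose w b hb using fun μ : ℝ => exists_hilbertBasis ℝ (Module.End.eigenspace T.toLinearMap μ)
  let v : (Σ μ : ℝ, w μ) → H := fun i => (b i.1 i.2 : H)
  have hv : Orthonormal ℝ v :=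
    hfam.orthonormal_sigma_orthonormal (v_family := fun μ => b μ) fun μ => (b μ).orthonormal
  have hsp : (Submodule.span ℝ (Set.range v))ᗮ = ⊥ := by
    rw [Submodule.eq_bot_iff]
    intro x hx
    rw [Submodule.eq_bot_iff] at hbot
    apply hbot
    rw [Submodule.mem_orthogonal]
    intro u hu
    refine Submodule.iSup_induction (fun μ : ℝ => Module.End.eigenspace T.toLinearMap μ)
      (motive := fun u => inner ℝ u x = 0) hu ?_ ?_ ?_
    · intro μ u hu
      have h1 := ((Module.End.eigenspace T.toLinearMap μ).subtypeL).hasSum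
        ((b μ).hasSum_repr ⟨u, hu⟩)
      have h2 := (innerSL ℝ x).hasSum h1
      have h3 : inner ℝ x u = (0:ℝ) := by
        refine h2.unique ?_
        convert hasSum_zero with i
        have h4 := (Submodule.mem_orthogonal' _ _).1 hx (v ⟨μ, i⟩)
          (Submodule.subset_span ⟨_, rfl⟩)
        simp only [innerSL_apply_apply, map_smul]
        exact mul_eq_zero_of_right _ h4
      rw [real_inner_comm]
      exact h3
    · simp
    · intro y z hy hz
      rw [inner_add_left, hy, hz, add_zero]
  have hcount : Countable (Σ μ : ℝ, w μ) := by
    have hd : Pairwise fun i j => (1:ℝ) ≤ dist (v i) (v j) := by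
      intro i j hij
      have h0 : inner ℝ (v i) (v j) = 0 := hv.2 hij
      have h1 : ‖v i - v j‖ ^ 2 = 2 := by
        rw [norm_sub_sq_real, h0, hv.1, hv.1]
        norm_num
      rw [dist_eq_norm]
      nlinarith [norm_nonneg (v i - v j)]
    have hdj : Pairwise fun i j => Disjoint (Metric.ball (v i) (1/2)) (Metric.ball (v j) (1/2)) :=
      fun i j hij => Metric.ball_disjoint_ball (by linarith [hd hij])
    have := Set.PairwiseDisjoint.countable_of_isOpen (a := Set.univ)
      (s := fun i => Metric.ball (v i) (1/2)) (fun i _ j _ hij => hdj hij)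
      (fun i _ => Metric.isOpen_ball) (fun i _ => ⟨v i, Metric.mem_ball_self (by norm_num)⟩)
    exact Set.countable_univ_iff.1 this
  have hinf : Infinite (Σ μ : ℝ, w μ) := by
    by_contra hfin
    rw [not_infinite_iff_finite] at hfin
    have := Fintype.ofFinite (Σ μ : ℝ, w μ)
    exact hH (Module.Finite.of_basis
      (HilbertBasis.mkOfOrthogonalEqBot hv hsp).toOrthonormalBasis.toBasis)
  obtain ⟨φ⟩ := nonempty_equiv_of_countable (α := ℕ) (β := Σ μ : ℝ, w μ)
  have hv' : Orthonormal ℝ (v ∘ φ) := hv.comp _ φ.injective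
  have hsp' : (Submodule.span ℝ (Set.range (v ∘ φ)))ᗮ = ⊥ := by
    rwa [φ.surjective.range_comp]
  refine ⟨HilbertBasis.mkOfOrthogonalEqBot hv' hsp', fun k => -(φ k).1⁻¹, fun k => ?_⟩
  rw [HilbertBasis.coe_mkOfOrthogonalEqBot]
  have hev : T ((v ∘ φ) k) = (φ k).1 • (v ∘ φ) k := by
    have := (b (φ k).1 (φ k).2).2
    rwa [Module.End.mem_eigenspace_iff] at this
  have hne : (v ∘ φ) k ≠ 0 := hv'.ne_zero k
  have hμ : (φ k).1 ≠ 0 := by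
    intro h
    rw [h, zero_smul] at hev
    exact hne (hinj _ hev)
  obtain ⟨hd, hd'⟩ := hT1 ((v ∘ φ) k)
  have hx : (v ∘ φ) k = (φ k).1⁻¹ • T ((v ∘ φ) k) := by
    rw [hev, smul_smul, inv_mul_cancel₀ hμ, one_smul]
  have hm : (v ∘ φ) k ∈ A.domain := by
    rw [hx]
    exact A.domain.smul_mem _ hd
  refine ⟨hm, ?_⟩
  have : (⟨(v ∘ φ) k, hm⟩ : A.domain) = (φ k).1⁻¹ • ⟨T ((v ∘ φ) k), hd⟩ := Subtype.ext hx
  rw [this, A.map_smul, hd', neg_neg]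

/-- The semigroup `e^{tA} x = ∑ₖ e^{-λₖ t} ⟨x, eₖ⟩ eₖ`. -/
def semigroup (e : HilbertBasis ℕ ℝ H) (lam : ℕ → ℝ) (t : ℝ) (x : H) : H :=
  ∑' k, (Real.exp (-lam k * t) * inner ℝ (e k) x) • e k

/-- `Γₜ z = (-A)^{-1/2} (z - e^{tA} z) = ∑ₖ (1 - e^{-λₖ t}) λₖ^{-1/2} ⟨z, eₖ⟩ eₖ`. -/
def drift (e : HilbertBasis ℕ ℝ H) (lam : ℕ → ℝ) (t : ℝ) (z : H) : H :=
  ∑' k, ((1 - Real.exp (-lam k * t)) / √(lam k) * inner ℝ (e k) z) • e k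

/-- The unbounded operator `(-A)^{1/2}`. Its domain consists of the `x` for which
`(λₖ^{1/2} ⟨eₖ, x⟩)ₖ` is square summable, and `(-A)^{1/2} x` is the vector with these
coordinates. -/
def sqrtNeg (e : HilbertBasis ℕ ℝ H) (lam : ℕ → ℝ) : H →ₗ.[ℝ] H where
  domain :=
    { carrier := {x | Memℓp (fun k => √(lam k) * inner ℝ (e k) x) 2}
      add_mem' := fun {x y} hx hy => by
        have h : Memℓp _ 2 := Memℓp.add hx hy
        have hxy : (fun k => √(lam k) * inner ℝ (e k) (x + y)) =
            (fun k => √(lam k) * inner ℝ (e k) x) + fun k => √(lam k) * inner ℝ (e k) y := by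
          funext k
          simp [inner_add_right, mul_add]
        rw [mem_ofPred_eq, hxy]
        exact h
      zero_mem' := by
        have h : Memℓp (0 : ℕ → ℝ) 2 := zero_memℓp
        have h0 : (fun k => √(lam k) * inner ℝ (e k) (0 : H)) = 0 := by
          funext k
          simp
        rw [mem_ofPred_eq, h0]
        exact h
      smul_mem' := fun c x hx => by
        have h : Memℓp _ 2 := Memℓp.const_smul hx c
        have hcx : (fun k => √(lam k) * inner ℝ (e k) (c • x)) =
            c • fun k => √(lam k) * inner ℝ (e k) x := by
          funext k
          simp [inner_smul_right, mul_left_comm]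
        rw [mem_ofPred_eq, hcx]
        exact h }
  toFun :=
    { toFun := fun x => e.repr.symm ⟨fun k => √(lam k) * inner ℝ (e k) (x : H), x.2⟩
      map_add' := fun x y => by
        rw [← map_add]
        congr 1
        ext k
        change √(lam k) * inner ℝ (e k) ((x : H) + y) =
          √(lam k) * inner ℝ (e k) (x : H) + √(lam k) * inner ℝ (e k) (y : H)
        rw [inner_add_right, mul_add]
      map_smul' := fun c x => by
        rw [RingHom.id_apply, ← map_smul]
        congr 1
        ext k
        simp [inner_smul_right, mul_left_comm] }

/-- The eigenvalues of the covariance operator `Qₜ = ∫₀ᵗ e^{2sA} ds = (-2A)⁻¹ (I - e^{2tA})`. -/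
def covEigenvalue (lam : ℕ → ℝ) (t : ℝ) (k : ℕ) : ℝ≥0 :=
  ((1 - Real.exp (-2 * lam k * t)) / (2 * lam k)).toNNReal

end Operators

section Gaussian

variable [MeasurableSpace H]

/-- The centred Gaussian measure on `H` whose covariance operator is the trace class operator with
`Q eₖ = qₖ eₖ`: the law of `∑ₖ ξₖ eₖ`, where the `ξₖ` are independent with law `N(0, qₖ)`. -/
def gaussianMeasure (e : HilbertBasis ℕ ℝ H) (q : ℕ → ℝ≥0) : Measure H :=
  (Measure.infinitePi fun k => gaussianReal 0 (q k)).map fun ξ : ℕ → ℝ => ∑' k, ξ k • e k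

theorem measurable_gaussianSeries [CompleteSpace H] [TopologicalSpace.SeparableSpace H]
    [BorelSpace H] (e : HilbertBasis ℕ ℝ H) :
    Measurable fun ξ : ℕ → ℝ => ∑' k, ξ k • e k := by
  have hsum : ∀ ξ : ℕ → ℝ, Summable (fun k => ξ k • e k) ↔ ∑' k, ENNReal.ofReal (ξ k ^ 2) ≠ ∞ := by
    intro ξ
    have h1 := e.orthonormal.orthogonalFamily.summable_iff_norm_sq_summable ξ
    simp only [LinearIsometry.toSpanSingleton_apply, Real.norm_eq_abs, sq_abs] at h1
    rw [h1]
    refine ⟨fun h => h.tsum_ofReal_ne_top, fun h => ?_⟩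
    have h2 := ENNReal.summable_toReal h
    simpa [ENNReal.toReal_ofReal, sq_nonneg] using h2
  have hS : MeasurableSet {ξ : ℕ → ℝ | ∑' k, ENNReal.ofReal (ξ k ^ 2) ≠ ∞} :=
    (measurableSet_singleton ∞).compl.preimage
      (Measurable.tsum fun k => ENNReal.measurable_ofReal.comp ((measurable_pi_apply k).pow_const 2))
  have hlim : ∀ ξ : ℕ → ℝ, Tendsto
      (fun n => {ξ : ℕ → ℝ | ∑' k, ENNReal.ofReal (ξ k ^ 2) ≠ ∞}.indicator
        (fun ξ => ∑ k ∈ Finset.range n, ξ k • e k) ξ) atTop (𝓝 (∑' k, ξ k • e k)) := by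
    intro ξ
    by_cases h : Summable (fun k => ξ k • e k)
    · have hm : ξ ∈ {ξ : ℕ → ℝ | ∑' k, ENNReal.ofReal (ξ k ^ 2) ≠ ∞} := (hsum ξ).1 h
      simp only [indicator_of_mem hm]
      exact h.hasSum.tendsto_sum_nat
    · have hm : ξ ∉ {ξ : ℕ → ℝ | ∑' k, ENNReal.ofReal (ξ k ^ 2) ≠ ∞} :=
        fun h' => h ((hsum ξ).2 h')
      simp only [indicator_of_notMem hm, tsum_eq_zero_of_not_summable h]
      exact tendsto_const_nhds
  have : SecondCountableTopology H := UniformSpace.secondCountable_of_separable H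
  refine measurable_of_tendsto_metrizable (fun n => ?_) (tendsto_pi_nhds.2 hlim)
  refine Measurable.indicator ?_ hS
  exact Finset.measurable_sum _ fun k _ => (measurable_pi_apply k).smul_const _

instance [CompleteSpace H] [TopologicalSpace.SeparableSpace H]
    [BorelSpace H] (e : HilbertBasis ℕ ℝ H) (q : ℕ → ℝ≥0) :
    IsProbabilityMeasure (gaussianMeasure e q) :=
  Measure.isProbabilityMeasure_map (measurable_gaussianSeries e).aemeasurable

/-- The generalised Ornstein-Uhlenbeck semigroup
`Pₜ⁽ᶻ⁾ f (x) = ∫ f (e^{tA} x + y + Γₜ z) N(0, Qₜ)(dy)`. -/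
def ouSemigroup (e : HilbertBasis ℕ ℝ H) (lam : ℕ → ℝ) (z : H) (t : ℝ) (f : H → ℝ) (x : H) : ℝ :=
  ∫ y, f (semigroup e lam t x + y + drift e lam t z) ∂gaussianMeasure e (covEigenvalue lam t)

/-- `u⁽ᶻ⁾(x) = ∫₀^∞ e^{-rt} Pₜ⁽ᶻ⁾ f (x) dt`. -/
def ouResolvent (e : HilbertBasis ℕ ℝ H) (lam : ℕ → ℝ) (z : H) (r : ℝ) (f : H → ℝ) (x : H) : ℝ :=
  ∫ t in Ioi (0 : ℝ), Real.exp (-r * t) * ouSemigroup e lam z t f x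

end Gaussian

section FunctionSpaces

variable {E : Type*} [NormedAddCommGroup E]

/-- The supremum norm `‖g‖₀`, with value `∞` for unbounded `g`. -/
def supNorm (g : H → E) : ℝ≥0∞ := ⨆ x, ‖g x‖ₑ

/-- The norm of `C_b^θ(H, E)`, the supremum norm plus the `θ`-Hölder seminorm, with value `∞`
exactly when `g` is not both bounded and `θ`-Hölder continuous. -/
def holderNorm (θ : ℝ≥0) (g : H → E) : ℝ≥0∞ := supNorm g + eHolderNorm θ g

/-- Membership in `C_b^θ(H, E)`. -/
def IsCbHolder (θ : ℝ≥0) (g : H → E) : Prop := holderNorm θ g < ∞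

/-- Membership in `C_b^1(H)`: `u` is bounded and Fréchet differentiable, with a bounded and
continuous derivative. -/
def IsCbOne (u : H → ℝ) : Prop :=
  ContDiff ℝ 1 u ∧ supNorm u < ∞ ∧ supNorm (fderiv ℝ u) < ∞

/-- `G` is the function `(-A)^{1/2} Du`: for every `x`, the gradient `Du(x)` belongs to
`D((-A)^{1/2})` and `G x = (-A)^{1/2} Du(x)`. -/
def IsSqrtNegGradient [CompleteSpace H] (e : HilbertBasis ℕ ℝ H) (lam : ℕ → ℝ) (u : H → ℝ)
    (G : H → H) : Prop :=
  ∀ x, ∃ h : gradient u x ∈ (sqrtNeg e lam).domain, G x = sqrtNeg e lam ⟨gradient u x, h⟩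

end FunctionSpaces

end OrnsteinUhlenbeck

end

open OrnsteinUhlenbeck

set_option linter.unusedSectionVars false

/-! The drift `Γₜ z` merely translates the argument of `f`, so every bound is automatically uniform
in `z`. The smoothing comes from the Cameron–Martin formula. Since `e^{tA} g = Qₜ w` with `w = Qₜ⁻¹
e^{tA} g`, moving `x` by `g` translates the Gaussian measure along its Cameron–Martin space, and `⟨D
Pₜ f(x), g⟩ = ∫ f(m + y) ⟨w, y⟩ N(0, Qₜ)(dy)` with `m = e^{tA} x + Γₜ z`. The size of this shift is
`⟨Qₜ w, w⟩ ≤ |g|² / t`. Inserting `(-A)^{1/2}` replaces the bound by `|g|² / t²`.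

The Hölder regularity of `f` has to gain a factor `t^{θ/2}` with a constant independent of `A`.
Subtracting the value of `f` at the centre would bring in moments of `|y|`, hence the trace of `Qₜ`.
Instead the Gaussian is split into an independent pair: a part orthogonal to `w` and a standard
normal multiple of `Qₜ w / √⟨Qₜ w, w⟩`. That last vector has length at most `√t` because `Qₜ ≤ t`.
On each line the oscillation of `f` is of order `[f] t^{θ/2}`, and only one-dimensional normal
integrals remain (`IsCenteredGaussian.abs_integral_le_of_fiber`, `fiber_coarse_lipschitz`).

This yields `|(-A)^{1/2} D Pₜ f| ≤ c [f] t^{θ/2 - 1}` (`exists_norm_ouGradient_le`), a Lipschitz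
constant `c [f] t^{θ/2 - 3/2}` for the same map (`exists_norm_ouGradient_sub_le`), and a quadratic
Taylor remainder for `Pₜ f` of order `t^{θ/2 - 1}` (`exists_abs_ouSemigroup_taylor_le`). The
Lipschitz bound comes from writing the Gaussian as the sum of two independent halves, one absorbing
the derivative and the other the translation.

Integrating against `e^{-λt}`, the exponent `θ/2 - 1` is integrable at zero. This gives
differentiability of `u` and the supremum bound, with constant a multiple of `Γ(θ/2) λ^{-θ/2}`. For
the Hölder bound the time integral is split at `t = |x - x'|²`, with the supremum estimate before
and the Lipschitz estimate after. The tail converges because `θ < 1`. Part (ii) is dominated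
convergence in the Gaussian variable and then in time. -/

namespace OrnsteinUhlenbeck

/-! ### One-dimensional estimates for the standard normal law -/

section StandardNormal

local notation "γ" => gaussianReal 0 1

theorem integrable_exp_mul_abs_gaussianReal (a : ℝ) :
    Integrable (fun s : ℝ => Real.exp (a * |s|)) γ :=
  integrable_exp_mul_abs (X := id) (integrable_exp_mul_gaussianReal a)
    (integrable_exp_mul_gaussianReal (-a))

/-- The Cameron–Martin formula on the line: substitute `s - c` for `s` and complete the square in
the density. -/
theorem integral_gaussianReal_add (φ : ℝ → ℝ) (c : ℝ) :
    ∫ s, φ (s + c) ∂γ = ∫ s, φ s * Real.exp (c * s - c ^ 2 / 2) ∂γ := by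
  rw [integral_gaussianReal_eq_integral_smul one_ne_zero,
    integral_gaussianReal_eq_integral_smul one_ne_zero,
    ← integral_sub_right_eq_self (fun s => gaussianPDFReal 0 1 s • φ (s + c)) c]
  congr 1 with s
  simp only [gaussianPDFReal, smul_eq_mul, sub_add_cancel, NNReal.coe_one, mul_one, sub_zero]
  rw [show -(s - c) ^ 2 / 2 = -s ^ 2 / 2 + (c * s - c ^ 2 / 2) by ring, Real.exp_add]
  ring

theorem one_add_abs_le_exp (s : ℝ) : 1 + |s| ≤ Real.exp |s| := by
  linarith [Real.add_one_le_exp |s|]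

theorem abs_tilt_le {c : ℝ} (hc : |c| ≤ 1) (s : ℝ) : |c * s - c ^ 2 / 2| ≤ |c| * (1 + |s|) := by
  have h1 := abs_nonneg c
  have h2 : c ^ 2 = |c| ^ 2 := (sq_abs c).symm
  have h3 : |c * s| = |c| * |s| := abs_mul c s
  have h4 := abs_sub (c * s) (c ^ 2 / 2)
  rw [abs_of_nonneg (a := c ^ 2 / 2) (by positivity), h2, h3] at h4
  rw [h2]
  nlinarith

theorem abs_exp_tilt_sub_one_le {c : ℝ} (hc : |c| ≤ 1) (s : ℝ) :
    |Real.exp (c * s - c ^ 2 / 2) - 1| ≤ |c| * (Real.exp 1 * Real.exp (2 * |s|)) := by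
  have ha := abs_tilt_le hc s
  set a := c * s - c ^ 2 / 2
  have h1 : |Real.exp a - 1| ≤ |a| * Real.exp |a| := by
    have := Real.add_one_le_exp a
    have h5 := Real.add_one_le_exp (-a)
    have h6 : Real.exp a * Real.exp (-a) = 1 := by rw [← Real.exp_add]; simp
    have h7 : Real.exp a ≤ Real.exp |a| := Real.exp_le_exp.2 (le_abs_self a)
    have h8 : 1 ≤ Real.exp |a| := Real.one_le_exp (abs_nonneg a)
    rw [abs_le]
    have h9 := neg_abs_le a
    have h10 := le_abs_self a
    have h11 := abs_nonneg a
    have h12 := Real.exp_pos a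
    constructor
    · nlinarith
    · nlinarith [mul_le_mul_of_nonneg_left h7 h11]
  have h2 : |a| ≤ 1 + |s| := ha.trans (by nlinarith [abs_nonneg s])
  calc _ ≤ |a| * Real.exp |a| := h1
    _ ≤ (|c| * Real.exp |s|) * Real.exp (1 + |s|) := by
        gcongr
        exact ha.trans (by gcongr; exact one_add_abs_le_exp s)
    _ = _ := by rw [Real.exp_add, two_mul, Real.exp_add]; ring

/-- With `a = c s - c² / 2`, the remainder `e^a - 1 - a` is `O(a² e^{|a|})`, and replacing `a` by `c
s` costs only `c² / 2`. Powers of `1 + |s|` are absorbed into exponentials. -/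
theorem abs_exp_tilt_sub_le {c : ℝ} (hc : |c| ≤ 1) (s : ℝ) :
    |Real.exp (c * s - c ^ 2 / 2) - 1 - c * s| ≤
      c ^ 2 * (2 * Real.exp 1 * Real.exp (3 * |s|)) := by
  have ha := abs_tilt_le hc s
  have he : Real.exp (c * s - c ^ 2 / 2) - 1 - c * s =
    (Real.exp (c * s - c ^ 2 / 2) - 1 - (c * s - c ^ 2 / 2)) - c ^ 2 / 2 := by ring
  rw [he]
  set a := c * s - c ^ 2 / 2
  have h2 : |a| ≤ 1 + |s| := ha.trans (by nlinarith [abs_nonneg s])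
  have h1 : |Real.exp a - 1 - a| ≤ a ^ 2 * Real.exp |a| := by
    have h := Complex.norm_exp_sub_sum_le_norm_mul_exp a 2
    have h' : Complex.exp a - ∑ m ∈ Finset.range 2, (a : ℂ) ^ m / (m.factorial : ℂ) =
        ((Real.exp a - 1 - a : ℝ) : ℂ) := by
      simp [Finset.sum_range_succ, sub_sub]
    rwa [h', Complex.norm_real, Complex.norm_real, Real.norm_eq_abs, Real.norm_eq_abs,
      sq_abs] at h
  have h3 : a ^ 2 ≤ c ^ 2 * Real.exp (2 * |s|) := by
    rw [← sq_abs a, ← sq_abs c, two_mul, Real.exp_add, ← sq, ← mul_pow]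
    gcongr
    exact ha.trans (by gcongr; exact one_add_abs_le_exp s)
  have h4 : 1 ≤ Real.exp 1 * Real.exp (3 * |s|) := by
    rw [← Real.exp_add]; exact Real.one_le_exp (by positivity)
  calc _ ≤ |Real.exp a - 1 - a| + |c ^ 2 / 2| := abs_sub _ _
    _ ≤ c ^ 2 * Real.exp (2 * |s|) * Real.exp (1 + |s|) + c ^ 2 := by
        rw [abs_of_nonneg (a := c ^ 2 / 2) (by positivity)]
        gcongr
        · exact h1.trans (by gcongr)
        · nlinarith [sq_nonneg c]
    _ = c ^ 2 * (Real.exp 1 * Real.exp (3 * |s|) + 1) := by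
        rw [Real.exp_add, show 3 * |s| = 2 * |s| + |s| by ring, Real.exp_add]; ring
    _ ≤ _ := by
        gcongr
        linarith

theorem abs_integral_le_of_abs_le_exp {g : ℝ → ℝ} {b a : ℝ}
    (hb : ∀ s, |g s| ≤ b * Real.exp (a * |s|)) :
    |∫ s, g s ∂γ| ≤ b * ∫ s, Real.exp (a * |s|) ∂γ := by
  rw [← integral_const_mul]
  exact norm_integral_le_of_norm_le ((integrable_exp_mul_abs_gaussianReal a).const_mul b)
    (Eventually.of_forall fun s => (Real.norm_eq_abs _).trans_le (hb s))

theorem integrable_of_bounded {φ : ℝ → ℝ} {S : ℝ} (hφ : Measurable φ) (hS : ∀ s, |φ s| ≤ S) :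
    Integrable φ γ :=
  Integrable.of_bound hφ.aestronglyMeasurable S (Eventually.of_forall hS)

theorem integrable_exp_tilt (c : ℝ) : Integrable (fun s => Real.exp (c * s - c ^ 2 / 2)) γ := by
  simp_rw [sub_eq_add_neg, Real.exp_add]
  exact (integrable_exp_mul_gaussianReal c).mul_const _

theorem integrable_id_gaussianReal : Integrable (fun s : ℝ => s) γ :=
  (memLp_id_gaussianReal 1).integrable le_rfl

theorem integral_self_gaussianReal : ∫ s, s ∂γ = 0 := integral_id_gaussianReal

/-- The translation estimate for bounded functions under the standard normal law. -/
theorem exists_abs_integral_shift_sub_le : ∃ c₀ : ℝ, 0 < c₀ ∧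
    ∀ (φ : ℝ → ℝ) (S c : ℝ), Measurable φ → (∀ s, |φ s| ≤ S) →
      |∫ s, φ (s + c) - φ s ∂γ| ≤ c₀ * S * |c| := by
  have hI : 0 ≤ ∫ s, Real.exp (2 * |s|) ∂γ := integral_nonneg fun _ => (Real.exp_pos _).le
  -- The integral pays for `|c| ≤ 1`, where the density ratio is within `O(|c|)` of 1. The summand 2
  -- pays for `|c| ≥ 1`, where the trivial bound `2 S` is at most `2 S |c|`.
  refine ⟨Real.exp 1 * (∫ s, Real.exp (2 * |s|) ∂γ) + 2, by positivity, fun φ S c hφ hS => ?_⟩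
  have hS0 : 0 ≤ S := (abs_nonneg _).trans (hS 0)
  rcases le_total |c| 1 with hc | hc
  · have h1 : ∫ s, φ (s + c) - φ s ∂γ = ∫ s, φ s * (Real.exp (c * s - c ^ 2 / 2) - 1) ∂γ := by
      rw [integral_sub (integrable_of_bounded (by fun_prop) fun s => hS (s + c))
        (integrable_of_bounded hφ hS), integral_gaussianReal_add, ← integral_sub]
      · simp_rw [mul_sub, mul_one]
      · exact (integrable_exp_tilt c).bdd_mul hφ.aestronglyMeasurable (Eventually.of_forall hS)
      · exact integrable_of_bounded hφ hS
    rw [h1]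
    refine (abs_integral_le_of_abs_le_exp (b := S * |c| * Real.exp 1) (a := 2) fun s => ?_).trans ?_
    · rw [abs_mul]
      calc _ ≤ S * (|c| * (Real.exp 1 * Real.exp (2 * |s|))) := by
            gcongr
            · exact hS s
            · exact abs_exp_tilt_sub_one_le hc s
        _ = _ := by ring
    · nlinarith [mul_nonneg hS0 (abs_nonneg c)]
  · have h1 : |∫ s, φ (s + c) - φ s ∂γ| ≤ 2 * S := by
      have := norm_integral_le_of_norm_le_const (μ := γ) (f := fun s => φ (s + c) - φ s)
        (C := 2 * S) (Eventually.of_forall fun s =>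
          (abs_sub _ _).trans (by linarith [hS s, hS (s + c)]))
      simpa using this
    refine h1.trans ?_
    have : 0 ≤ Real.exp 1 * ∫ s, Real.exp (2 * |s|) ∂γ := by positivity
    nlinarith [mul_nonneg this (mul_nonneg hS0 (abs_nonneg c)),
      mul_le_mul_of_nonneg_left hc hS0]

/-- The first moment of a function with controlled oscillation under the standard normal law. -/
theorem exists_abs_integral_mul_self_le : ∃ c₁ : ℝ, 0 < c₁ ∧
    ∀ (φ : ℝ → ℝ) (S L : ℝ), Measurable φ → (∀ s, |φ s| ≤ S) →
      (∀ s s', |φ s - φ s'| ≤ L * (1 + |s - s'|)) → |∫ s, φ s * s ∂γ| ≤ c₁ * L := by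
  refine ⟨∫ s, Real.exp (2 * |s|) ∂γ, ?_, fun φ S L hφ hS hL => ?_⟩
  · exact integral_exp_pos (integrable_exp_mul_abs_gaussianReal 2)
  have hL0 : 0 ≤ L := by simpa using hL 0 0
  -- The law is centred, so a constant may be subtracted from `φ`. The bound then sees the
  -- oscillation `L` rather than the supremum `S`.
  have h1 : ∫ s, φ s * s ∂γ = ∫ s, (φ s - φ 0) * s ∂γ := by
    simp_rw [sub_mul]
    rw [integral_sub, integral_const_mul, integral_self_gaussianReal, mul_zero, sub_zero]
    · exact integrable_id_gaussianReal.bdd_mul hφ.aestronglyMeasurable (Eventually.of_forall hS)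
    · exact integrable_id_gaussianReal.const_mul _
  rw [h1, mul_comm]
  refine abs_integral_le_of_abs_le_exp fun s => ?_
  rw [abs_mul, two_mul, Real.exp_add]
  have h2 := hL s 0
  rw [sub_zero] at h2
  have h3 := one_add_abs_le_exp s
  calc _ ≤ L * Real.exp |s| * Real.exp |s| := by
        gcongr
        · exact h2.trans (by gcongr)
        · linarith
    _ = _ := by ring

/-- The first order Taylor estimate for a function with controlled oscillation under the standard
normal law. -/
theorem exists_abs_integral_taylor_le : ∃ c₃ : ℝ, 0 < c₃ ∧
    ∀ (φ : ℝ → ℝ) (S L c : ℝ), Measurable φ → (∀ s, |φ s| ≤ S) →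
      (∀ s s', |φ s - φ s'| ≤ L * (1 + |s - s'|)) →
      |∫ s, φ (s + c) - φ s - c * (φ s * s) ∂γ| ≤ c₃ * L * c ^ 2 := by
  obtain ⟨c₁, hc₁, H⟩ := exists_abs_integral_mul_self_le
  have hI : 0 ≤ ∫ s, Real.exp (4 * |s|) ∂γ := integral_nonneg fun _ => (Real.exp_pos _).le
  -- The integral serves `|c| ≤ 1`. For `|c| ≥ 1` the increment is at most `L (1 + |c|) ≤ 2 L c²`
  -- and the linear term at most `c₁ L |c| ≤ c₁ L c²`, whence `2 + c₁`.
  refine ⟨2 * Real.exp 1 * (∫ s, Real.exp (4 * |s|) ∂γ) + (2 + c₁), by positivity,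
    fun φ S L c hφ hS hL => ?_⟩
  have hL0 : 0 ≤ L := by simpa using hL 0 0
  have i1 : Integrable (fun s => φ (s + c)) γ :=
    integrable_of_bounded (by fun_prop) fun s => hS (s + c)
  have i2 : Integrable φ γ := integrable_of_bounded hφ hS
  have i3 : Integrable (fun s => φ s * s) γ :=
    integrable_id_gaussianReal.bdd_mul hφ.aestronglyMeasurable (Eventually.of_forall hS)
  have i4 : Integrable (fun s => φ s * Real.exp (c * s - c ^ 2 / 2)) γ :=
    (integrable_exp_tilt c).bdd_mul hφ.aestronglyMeasurable (Eventually.of_forall hS)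
  rcases le_total |c| 1 with hc | hc
  · have h0 : ∫ s, Real.exp (c * s - c ^ 2 / 2) ∂γ = 1 := by
      have := integral_gaussianReal_add (fun _ => (1 : ℝ)) c
      simpa using this.symm
    -- The factor `exp (c s - c² / 2) - 1 - c s` has mean zero, so `φ` may again be replaced by `φ -
    -- φ 0`.
    have h1 : ∫ s, φ (s + c) - φ s - c * (φ s * s) ∂γ =
        ∫ s, (φ s - φ 0) * (Real.exp (c * s - c ^ 2 / 2) - 1 - c * s) ∂γ := by
      rw [integral_sub (by exact i1.sub i2) (i3.const_mul c), integral_sub i1 i2,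
        integral_gaussianReal_add]
      have : (fun s => (φ s - φ 0) * (Real.exp (c * s - c ^ 2 / 2) - 1 - c * s)) = fun s =>
          (φ s * Real.exp (c * s - c ^ 2 / 2) - φ s - c * (φ s * s)) -
            φ 0 * (Real.exp (c * s - c ^ 2 / 2) - 1 - c * s) := by
        funext s; ring
      have i5 := integrable_exp_tilt c
      rw [this, integral_sub (by exact (i4.sub i2).sub (i3.const_mul c))
        (by exact ((i5.sub (integrable_const 1)).sub
          (integrable_id_gaussianReal.const_mul c)).const_mul _),
        integral_const_mul (φ 0), integral_sub (by exact i5.sub (integrable_const 1))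
          (integrable_id_gaussianReal.const_mul c), integral_sub i5 (integrable_const 1), h0,
        integral_const_mul c (fun s : ℝ => s), integral_self_gaussianReal,
        integral_sub (by exact i4.sub i2) (i3.const_mul c), integral_sub i4 i2]
      simp
    rw [h1]
    refine (abs_integral_le_of_abs_le_exp (b := L * c ^ 2 * (2 * Real.exp 1)) (a := 4)
      fun s => ?_).trans ?_
    · rw [abs_mul]
      have h2 := hL s 0
      rw [sub_zero] at h2
      have h3 := one_add_abs_le_exp s
      calc _ ≤ (L * Real.exp |s|) * (c ^ 2 * (2 * Real.exp 1 * Real.exp (3 * |s|))) := by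
            gcongr
            · exact h2.trans (by gcongr)
            · exact abs_exp_tilt_sub_le hc s
        _ = _ := by rw [show 4 * |s| = |s| + 3 * |s| by ring, Real.exp_add]; ring
    · nlinarith [mul_nonneg hL0 (sq_nonneg c)]
  · have hc2 : |c| ≤ c ^ 2 := by rw [← sq_abs]; nlinarith
    have h1 : |∫ s, φ (s + c) - φ s ∂γ| ≤ 2 * L * c ^ 2 := by
      have := norm_integral_le_of_norm_le_const (μ := γ) (f := fun s => φ (s + c) - φ s)
        (C := L * (1 + |c|)) (Eventually.of_forall fun s => by
          simpa using hL (s + c) s)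
      refine (show |∫ s, φ (s + c) - φ s ∂γ| ≤ L * (1 + |c|) by simpa using this).trans ?_
      nlinarith
    rw [integral_sub (by exact i1.sub i2) (i3.const_mul c), integral_const_mul]
    have h2 := H φ S L hφ hS hL
    have h3 : |c * ∫ s, φ s * s ∂γ| ≤ c₁ * L * c ^ 2 := by
      rw [abs_mul, mul_comm]
      gcongr
    refine (abs_sub _ _).trans ?_
    have : 0 ≤ 2 * Real.exp 1 * (∫ s, Real.exp (4 * |s|) ∂γ) * (L * c ^ 2) := by positivity
    nlinarith

end StandardNormal

/-! ### Gaussian measures on a Hilbert space and reduction to lines -/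

section AbstractGaussian

variable {H : Type*} [NormedAddCommGroup H] [InnerProductSpace ℝ H] [MeasurableSpace H]

/-- `ν` is the nondegenerate centred Gaussian measure with covariance operator `Q`. -/
structure IsCenteredGaussian (ν : Measure H) (Q : H →L[ℝ] H) : Prop where
  symm : ∀ x y, inner ℝ (Q x) y = inner ℝ x (Q y)
  pos : ∀ x, x ≠ 0 → 0 < inner ℝ (Q x) x
  charFun_eq : ∀ h, charFun ν h = Complex.exp ((-(inner ℝ (Q h) h / 2) : ℝ) : ℂ)

variable [CompleteSpace H] [TopologicalSpace.SeparableSpace H] [BorelSpace H]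
  {ν : Measure H} {Q : H →L[ℝ] H} [IsProbabilityMeasure ν]

/-- Through the Riesz vector of a functional, its law has the characteristic function of a real
normal variable. The result supplies the finite first moments used below. -/
theorem IsCenteredGaussian.isGaussian (hν : IsCenteredGaussian ν Q) : IsGaussian ν := by
  refine isGaussian_of_map_eq_gaussianReal fun L => ?_
  set w := (InnerProductSpace.toDual ℝ H).symm L with hw
  have hL : ∀ y, L y = inner ℝ w y := fun y => by simp [hw]
  have hV : 0 ≤ inner ℝ (Q w) w := by
    by_cases h : w = 0
    · simp [h]
    · exact (hν.pos w h).le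
  refine ⟨0, (inner ℝ (Q w) w).toNNReal, ?_⟩
  have : IsProbabilityMeasure (ν.map L) :=
    Measure.isProbabilityMeasure_map L.continuous.aemeasurable
  refine Measure.ext_of_charFun (funext fun t => ?_)
  have h1 : charFun (ν.map L) t = charFun ν (t • w) := by
    rw [charFun_apply, charFun_apply, integral_map (by fun_prop) (by fun_prop)]
    congr with y
    rw [hL, inner_smul_right, real_inner_comm, ← real_inner_comm y w]
    simp [mul_comm]
  rw [h1, hν.charFun_eq, charFun_gaussianReal, Real.coe_toNNReal _ hV]
  congr 1
  simp only [map_smul, inner_smul_left, inner_smul_right]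
  push_cast
  simp
  ring

/-- The projection along `Q w` onto the orthogonal complement of `w`. -/
noncomputable def fiberProj (Q : H →L[ℝ] H) (w y : H) : H :=
  y - (inner ℝ w y / inner ℝ (Q w) w) • Q w

theorem inner_fiberProj {w : H} (hw : inner ℝ (Q w) w ≠ 0) (y : H) :
    inner ℝ w (fiberProj Q w y) = 0 := by
  rw [fiberProj, inner_sub_right, inner_smul_right, real_inner_comm (Q w) w,
    div_mul_cancel₀ _ hw, sub_self]

theorem continuous_fiberProj (w : H) : Continuous (fiberProj Q w) := by
  unfold fiberProj
  fun_prop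

/-- A Gaussian measure splits off an independent one-dimensional component in any direction of its
Cameron-Martin space. -/
theorem IsCenteredGaussian.map_fiber (hν : IsCenteredGaussian ν Q) {w : H} (hw : w ≠ 0) :
    (ν.prod (gaussianReal 0 1)).map
      (fun p => fiberProj Q w p.1 + p.2 • ((√(inner ℝ (Q w) w))⁻¹ • Q w)) = ν := by
  have hsc : SecondCountableTopology H := UniformSpace.secondCountable_of_separable H
  have hV := hν.pos w hw
  set V := inner ℝ (Q w) w with hVdef
  set v := (√V)⁻¹ • Q w with hv
  have hT : Measurable (fiberProj Q w) := (continuous_fiberProj w).measurable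
  have hs : Measurable (fun s : ℝ => s • v) := by fun_prop
  have e1 : (fun p : H × ℝ => fiberProj Q w p.1 + p.2 • v) =
      (fun p : H × H => p.1 + p.2) ∘ Prod.map (fiberProj Q w) (fun s : ℝ => s • v) := rfl
  have : IsProbabilityMeasure (ν.map (fiberProj Q w)) :=
    Measure.isProbabilityMeasure_map hT.aemeasurable
  have : IsProbabilityMeasure ((gaussianReal 0 1).map fun s : ℝ => s • v) :=
    Measure.isProbabilityMeasure_map hs.aemeasurable
  rw [e1, ← Measure.map_map (by fun_prop) (by fun_prop), ← Measure.map_prod_map _ _ hT hs]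
  have : IsProbabilityMeasure (((ν.map (fiberProj Q w)).prod
      ((gaussianReal 0 1).map fun s : ℝ => s • v)).map (fun p : H × H => p.1 + p.2)) :=
    Measure.isProbabilityMeasure_map (by fun_prop)
  refine Measure.ext_of_charFun (funext fun t => ?_)
  rw [charFun_map_add_prod_eq_mul, Pi.mul_apply]
  -- The adjoint of the projection sends `t` to `t - (⟨Q w, t⟩ / V) w`.
  have h1 : charFun (ν.map (fiberProj Q w)) t =
      charFun ν (t - (inner ℝ (Q w) t / V) • w) := by
    rw [charFun_apply, charFun_apply, integral_map hT.aemeasurable (by fun_prop)]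
    congr with y
    congr 3
    rw [fiberProj, inner_sub_left, inner_sub_right, inner_smul_left, inner_smul_right,
      real_inner_comm w y]
    simp only [conj_trivial]
    ring
  have h2 : charFun ((gaussianReal 0 1).map fun s : ℝ => s • v) t =
      charFun (gaussianReal 0 1) (inner ℝ v t) := by
    rw [charFun_apply, charFun_apply, integral_map hs.aemeasurable (by fun_prop)]
    congr with s
    rw [inner_smul_left]
    simp [mul_comm]
  rw [h1, h2, hν.charFun_eq, hν.charFun_eq, charFun_gaussianReal, ← Complex.exp_add]
  congr 1
  have h3 : inner ℝ v t = (√V)⁻¹ * inner ℝ (Q w) t := by rw [hv, inner_smul_left]; simp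
  have h4 : (√V)⁻¹ ^ 2 = V⁻¹ := by rw [inv_pow, Real.sq_sqrt hV.le]
  have h5 : inner ℝ (Q t) w = inner ℝ (Q w) t := by rw [hν.symm, real_inner_comm]
  have h6 : (inner ℝ v t) ^ 2 = V⁻¹ * (inner ℝ (Q w) t) ^ 2 := by rw [h3, mul_pow, h4]
  -- Projecting lowers the variance in direction `t` by exactly `⟨Q w, t⟩² / V`, which is the
  -- variance contributed by the independent component along `Q w`.
  have h7 : inner ℝ (Q (t - (inner ℝ (Q w) t / V) • w)) (t - (inner ℝ (Q w) t / V) • w) =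
      inner ℝ (Q t) t - V⁻¹ * (inner ℝ (Q w) t) ^ 2 := by
    simp only [map_sub, map_smul, inner_sub_left, inner_sub_right, inner_smul_left,
      inner_smul_right, h5, conj_trivial, ← hVdef]
    field_simp
    ring
  rw [h7]
  have h8 : (((inner ℝ v t : ℝ) : ℂ)) ^ 2 = ((V⁻¹ * (inner ℝ (Q w) t) ^ 2 : ℝ) : ℂ) := by
    rw [← h6]; push_cast; rfl
  rw [h8]
  push_cast
  ring

/-- To bound the integral of `F` against a Gaussian measure it is enough to bound the
one-dimensional Gaussian integrals of `F` along the lines in a fixed direction. -/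
theorem IsCenteredGaussian.abs_integral_le_of_fiber (hν : IsCenteredGaussian ν Q) {w : H}
    (hw : w ≠ 0) {F : H → ℝ} (hF : Integrable F ν) {C : ℝ}
    (hC : ∀ p, inner ℝ w p = 0 →
      |∫ s, F (p + s • ((√(inner ℝ (Q w) w))⁻¹ • Q w)) ∂gaussianReal 0 1| ≤ C) :
    |∫ y, F y ∂ν| ≤ C := by
  have hsc : SecondCountableTopology H := UniformSpace.secondCountable_of_separable H
  have hm : Measurable (fun p : H × ℝ =>
      fiberProj Q w p.1 + p.2 • ((√(inner ℝ (Q w) w))⁻¹ • Q w)) := by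
    have := (continuous_fiberProj (Q := Q) w).measurable
    fun_prop
  have hmap := hν.map_fiber hw
  have hF' := hF
  rw [← hmap] at hF'
  have h1 := (integrable_map_measure hF'.1 hm.aemeasurable).1 hF'
  have h2 : ∫ y, F y ∂ν = ∫ y, ∫ s, F (fiberProj Q w y +
      s • ((√(inner ℝ (Q w) w))⁻¹ • Q w)) ∂gaussianReal 0 1 ∂ν := by
    conv_lhs => rw [← hmap]
    rw [integral_map hm.aemeasurable hF'.1]
    exact integral_prod _ h1
  rw [h2]
  have h3 := norm_integral_le_of_norm_le_const (μ := ν) (C := C)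
    (f := fun y => ∫ s, F (fiberProj Q w y +
      s • ((√(inner ℝ (Q w) w))⁻¹ • Q w)) ∂gaussianReal 0 1)
    (Eventually.of_forall fun y => hC _ (inner_fiberProj (hν.pos w hw).ne' y))
  simpa using h3

theorem IsCenteredGaussian.integrable_inner (hν : IsCenteredGaussian ν Q) (w : H) :
    Integrable (fun y => inner ℝ w y) ν := by
  have := hν.isGaussian
  have hsc : SecondCountableTopology H := UniformSpace.secondCountable_of_separable H
  exact IsGaussian.integrable_id.const_inner w

theorem IsCenteredGaussian.integrable_mul_inner (hν : IsCenteredGaussian ν Q) {f : H → ℝ} {S : ℝ}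
    (hf : Measurable f) (hS : ∀ x, |f x| ≤ S) (m w : H) :
    Integrable (fun y => f (m + y) * inner ℝ w y) ν :=
  (hν.integrable_inner w).bdd_mul (hf.comp (measurable_const_add m)).aestronglyMeasurable
    (Eventually.of_forall fun _ => hS _)

theorem integrable_shift {f : H → ℝ} {S : ℝ}
    (hf : Measurable f) (hS : ∀ x, |f x| ≤ S) (m : H) :
    Integrable (fun y => f (m + y)) ν :=
  Integrable.of_bound (hf.comp (measurable_const_add m)).aestronglyMeasurable S
    (Eventually.of_forall fun _ => hS _)

/-- Half of a Gaussian: the law of `y / √2`. -/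
theorem IsCenteredGaussian.map_half (hν : IsCenteredGaussian ν Q) :
    IsCenteredGaussian (ν.map fun y => (√2)⁻¹ • y) ((1 / 2 : ℝ) • Q) where
  symm x y := by simp [inner_smul_left, inner_smul_right, hν.symm]
  pos x hx := by
    have := hν.pos x hx
    simp [inner_smul_left, this]
  charFun_eq h := by
    rw [charFun_map_smul, hν.charFun_eq]
    congr 2
    have : (√2)⁻¹ * (√2)⁻¹ = (1 / 2 : ℝ) := by
      rw [← mul_inv, Real.mul_self_sqrt (by norm_num)]; norm_num
    simp only [map_smul, smul_apply, inner_smul_left, inner_smul_right,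
      conj_trivial, ← mul_assoc, this]

/-- A Gaussian is the convolution of its two halves. -/
theorem IsCenteredGaussian.map_add_half (hν : IsCenteredGaussian ν Q) :
    ((ν.map fun y => (√2)⁻¹ • y).prod (ν.map fun y => (√2)⁻¹ • y)).map
      (fun p : H × H => p.1 + p.2) = ν := by
  have hsc : SecondCountableTopology H := UniformSpace.secondCountable_of_separable H
  have h1 : IsProbabilityMeasure (ν.map fun y : H => (√2)⁻¹ • y) :=
    Measure.isProbabilityMeasure_map (by fun_prop)
  have : IsProbabilityMeasure (((ν.map fun y => (√2)⁻¹ • y).prod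
      (ν.map fun y => (√2)⁻¹ • y)).map (fun p : H × H => p.1 + p.2)) :=
    Measure.isProbabilityMeasure_map (by fun_prop)
  refine Measure.ext_of_charFun (funext fun t => ?_)
  rw [charFun_map_add_prod_eq_mul, Pi.mul_apply, hν.map_half.charFun_eq, hν.charFun_eq,
    ← Complex.exp_add]
  congr 1
  simp only [smul_apply, inner_smul_left, conj_trivial]
  push_cast
  ring

/-- The translation estimate for bounded functions. -/
theorem exists_abs_integral_translate_sub_le : ∃ c₀ : ℝ, 0 < c₀ ∧
    ∀ {H : Type*} [NormedAddCommGroup H] [InnerProductSpace ℝ H] [MeasurableSpace H]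
      [CompleteSpace H] [TopologicalSpace.SeparableSpace H] [BorelSpace H] {ν : Measure H}
      {Q : H →L[ℝ] H} [IsProbabilityMeasure ν], IsCenteredGaussian ν Q →
      ∀ (f : H → ℝ) (S : ℝ) (m w : H), Measurable f → (∀ x, |f x| ≤ S) →
      |∫ y, f (m + Q w + y) - f (m + y) ∂ν| ≤ c₀ * S * √(inner ℝ (Q w) w) := by
  obtain ⟨c₀, hc₀, h⟩ := exists_abs_integral_shift_sub_le
  refine ⟨c₀, hc₀, ?_⟩
  intro H _ _ _ _ _ _ ν Q _ hν f S m w hf hS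
  by_cases hw : w = 0
  · simp [hw]
  have hV := hν.pos w hw
  have hF : Integrable (fun y => f (m + Q w + y) - f (m + y)) ν :=
    (integrable_shift hf hS _).sub (integrable_shift hf hS _)
  refine hν.abs_integral_le_of_fiber hw hF fun p _ => ?_
  set σ := √(inner ℝ (Q w) w) with hσ
  have hσ0 : 0 < σ := Real.sqrt_pos.2 hV
  -- In the fibre coordinate, translation by `Q w` is translation of `s` by `σ`.
  have h1 := h (fun s => f (m + p + s • (σ⁻¹ • Q w))) S σ
    (hf.comp (by fun_prop)) fun s => hS _
  rw [abs_of_pos hσ0] at h1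
  convert h1 using 5 with s
  · rw [add_smul, smul_smul σ, mul_inv_cancel₀ hσ0.ne', one_smul]
    abel_nf
  · abel_nf

/-- The direction vector has length at most `√κ`, so only `κ`, and no trace of `Q`, enters the
oscillation along a line. Bounding `|s - s'|^θ` by `1 + |s - s'|` removes `θ` from the
one-dimensional problem, whose constants are therefore absolute. -/
theorem fiber_coarse_lipschitz {f : H → ℝ} {L θ κ : ℝ} (hθ0 : 0 ≤ θ) (hθ1 : θ ≤ 1) (hL0 : 0 ≤ L)
    (hL : ∀ x y, |f x - f y| ≤ L * ‖x - y‖ ^ θ) {w : H} (hV : 0 < inner ℝ (Q w) w) (hκ0 : 0 ≤ κ)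
    (hκ : ‖Q w‖ ^ 2 ≤ κ * inner ℝ (Q w) w) (p : H) (s s' : ℝ) :
    |f (p + s • ((√(inner ℝ (Q w) w))⁻¹ • Q w)) - f (p + s' • ((√(inner ℝ (Q w) w))⁻¹ • Q w))| ≤
      L * κ ^ (θ / 2) * (1 + |s - s'|) := by
  set σ := √(inner ℝ (Q w) w) with hσ
  have hσ0 : 0 < σ := Real.sqrt_pos.2 hV
  refine (hL _ _).trans ?_
  rw [mul_assoc]
  refine mul_le_mul_of_nonneg_left ?_ hL0
  have h1 : p + s • (σ⁻¹ • Q w) - (p + s' • (σ⁻¹ • Q w)) = (s - s') • (σ⁻¹ • Q w) := by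
    rw [sub_smul]; abel
  have h2 : ‖σ⁻¹ • Q w‖ ≤ κ ^ (1 / 2 : ℝ) := by
    rw [norm_smul, ← Real.sqrt_eq_rpow, Real.norm_of_nonneg (by positivity)]
    refine Real.le_sqrt_of_sq_le ?_
    rw [mul_pow, inv_pow, hσ, Real.sq_sqrt hV.le]
    rw [inv_mul_le_iff₀ hV]
    linarith
  rw [h1, norm_smul, Real.mul_rpow (norm_nonneg _) (norm_nonneg _), mul_comm]
  have h3 : ‖σ⁻¹ • Q w‖ ^ θ ≤ κ ^ (θ / 2) := by
    refine (Real.rpow_le_rpow (norm_nonneg _) h2 hθ0).trans_eq ?_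
    rw [← Real.rpow_mul hκ0]
    congr 1; ring
  have h4 : ‖s - s'‖ ^ θ ≤ 1 + |s - s'| := by
    rw [Real.norm_eq_abs]
    have h5 := abs_nonneg (s - s')
    calc |s - s'| ^ θ ≤ (1 + |s - s'|) ^ θ := by gcongr; linarith
      _ ≤ (1 + |s - s'|) ^ (1 : ℝ) := Real.rpow_le_rpow_of_exponent_le (by linarith) hθ1
      _ = _ := Real.rpow_one _
  gcongr

/-- The first moment estimate for Hölder functions. -/
theorem exists_abs_integral_mul_inner_le : ∃ c₁ : ℝ, 0 < c₁ ∧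
    ∀ {H : Type*} [NormedAddCommGroup H] [InnerProductSpace ℝ H] [MeasurableSpace H]
      [CompleteSpace H] [TopologicalSpace.SeparableSpace H] [BorelSpace H] {ν : Measure H}
      {Q : H →L[ℝ] H} [IsProbabilityMeasure ν], IsCenteredGaussian ν Q →
      ∀ (f : H → ℝ) (S L θ κ : ℝ) (m w : H), 0 ≤ θ → θ ≤ 1 → 0 ≤ κ →
        (∀ x, ‖Q x‖ ^ 2 ≤ κ * inner ℝ (Q x) x) → Measurable f → (∀ x, |f x| ≤ S) → 0 ≤ L →
        (∀ x y, |f x - f y| ≤ L * ‖x - y‖ ^ θ) →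
      |∫ y, f (m + y) * inner ℝ w y ∂ν| ≤ c₁ * (L * κ ^ (θ / 2)) * √(inner ℝ (Q w) w) := by
  obtain ⟨c₁, hc₁, h⟩ := exists_abs_integral_mul_self_le
  refine ⟨c₁, hc₁, ?_⟩
  intro H _ _ _ _ _ _ ν Q _ hν f S L θ κ m w hθ0 hθ1 hκ0 hκ hf hS hL0 hL
  by_cases hw : w = 0
  · simp [hw]
  have hV := hν.pos w hw
  refine hν.abs_integral_le_of_fiber hw (hν.integrable_mul_inner hf hS m w) fun p hp => ?_
  set σ := √(inner ℝ (Q w) w) with hσ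
  have hσ0 : 0 < σ := Real.sqrt_pos.2 hV
  have h1 := h (fun s => f (m + p + s • (σ⁻¹ • Q w))) S (L * κ ^ (θ / 2))
    (hf.comp (by fun_prop)) (fun s => hS _) fun s s' =>
      fiber_coarse_lipschitz hθ0 hθ1 hL0 hL hV hκ0 (hκ w) _ s s'
  -- As `p` is orthogonal to `w`, the linear weight restricts to `σ s` on the fibre.
  have h2 : ∀ s : ℝ, f (m + (p + s • (σ⁻¹ • Q w))) * inner ℝ w (p + s • (σ⁻¹ • Q w)) =
      σ * (f (m + p + s • (σ⁻¹ • Q w)) * s) := by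
    intro s
    have : σ⁻¹ * inner ℝ (Q w) w = σ := by
      rw [← Real.mul_self_sqrt hV.le, ← hσ]; field_simp
    rw [inner_add_right, hp, zero_add, inner_smul_right, inner_smul_right, real_inner_comm (Q w) w,
      this, add_assoc]
    ring
  simp_rw [h2]
  rw [integral_const_mul, abs_mul, abs_of_pos hσ0, mul_comm]
  gcongr

/-- The first order Taylor estimate for Hölder functions. -/
theorem exists_abs_integral_translate_taylor_le : ∃ c₃ : ℝ, 0 < c₃ ∧
    ∀ {H : Type*} [NormedAddCommGroup H] [InnerProductSpace ℝ H] [MeasurableSpace H]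
      [CompleteSpace H] [TopologicalSpace.SeparableSpace H] [BorelSpace H] {ν : Measure H}
      {Q : H →L[ℝ] H} [IsProbabilityMeasure ν], IsCenteredGaussian ν Q →
      ∀ (f : H → ℝ) (S L θ κ : ℝ) (m w : H), 0 ≤ θ → θ ≤ 1 → 0 ≤ κ →
        (∀ x, ‖Q x‖ ^ 2 ≤ κ * inner ℝ (Q x) x) → Measurable f → (∀ x, |f x| ≤ S) → 0 ≤ L →
        (∀ x y, |f x - f y| ≤ L * ‖x - y‖ ^ θ) →
      |∫ y, f (m + Q w + y) - f (m + y) - f (m + y) * inner ℝ w y ∂ν| ≤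
        c₃ * (L * κ ^ (θ / 2)) * inner ℝ (Q w) w := by
  obtain ⟨c₃, hc₃, h⟩ := exists_abs_integral_taylor_le
  refine ⟨c₃, hc₃, ?_⟩
  intro H _ _ _ _ _ _ ν Q _ hν f S L θ κ m w hθ0 hθ1 hκ0 hκ hf hS hL0 hL
  by_cases hw : w = 0
  · simp [hw]
  have hV := hν.pos w hw
  have hF : Integrable (fun y => f (m + Q w + y) - f (m + y) - f (m + y) * inner ℝ w y) ν :=
    ((integrable_shift hf hS _).sub (integrable_shift hf hS _)).sub
      (hν.integrable_mul_inner hf hS m w)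
  refine hν.abs_integral_le_of_fiber hw hF fun p hp => ?_
  set σ := √(inner ℝ (Q w) w) with hσ
  have hσ0 : 0 < σ := Real.sqrt_pos.2 hV
  have h1 := h (fun s => f (m + p + s • (σ⁻¹ • Q w))) S (L * κ ^ (θ / 2)) σ
    (hf.comp (by fun_prop)) (fun s => hS _) fun s s' =>
      fiber_coarse_lipschitz hθ0 hθ1 hL0 hL hV hκ0 (hκ w) _ s s'
  rw [hσ, Real.sq_sqrt hV.le, ← hσ] at h1
  have h2 : ∀ s : ℝ, f (m + Q w + (p + s • (σ⁻¹ • Q w))) - f (m + (p + s • (σ⁻¹ • Q w))) -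
      f (m + (p + s • (σ⁻¹ • Q w))) * inner ℝ w (p + s • (σ⁻¹ • Q w)) =
      f (m + p + (s + σ) • (σ⁻¹ • Q w)) - f (m + p + s • (σ⁻¹ • Q w)) -
        σ * (f (m + p + s • (σ⁻¹ • Q w)) * s) := by
    intro s
    have : σ⁻¹ * inner ℝ (Q w) w = σ := by
      rw [← Real.mul_self_sqrt hV.le, ← hσ]; field_simp
    have e1 : m + p + (s + σ) • (σ⁻¹ • Q w) = m + Q w + (p + s • (σ⁻¹ • Q w)) := by
      rw [add_smul, smul_smul σ, mul_inv_cancel₀ hσ0.ne', one_smul]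
      abel
    rw [e1, inner_add_right, hp, zero_add, inner_smul_right, inner_smul_right,
      real_inner_comm (Q w) w, this, add_assoc m p]
    ring
  simp_rw [h2]
  exact h1

/-- The translation estimate for the first moment of Hölder functions. -/
theorem exists_abs_integral_translate_sub_mul_inner_le : ∃ c₂ : ℝ, 0 < c₂ ∧
    ∀ {H : Type*} [NormedAddCommGroup H] [InnerProductSpace ℝ H] [MeasurableSpace H]
      [CompleteSpace H] [TopologicalSpace.SeparableSpace H] [BorelSpace H] {ν : Measure H}
      {Q : H →L[ℝ] H} [IsProbabilityMeasure ν], IsCenteredGaussian ν Q →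
      ∀ (f : H → ℝ) (S L θ κ : ℝ) (m w w' : H), 0 ≤ θ → θ ≤ 1 → 0 ≤ κ →
        (∀ x, ‖Q x‖ ^ 2 ≤ κ * inner ℝ (Q x) x) → Measurable f → (∀ x, |f x| ≤ S) → 0 ≤ L →
        (∀ x y, |f x - f y| ≤ L * ‖x - y‖ ^ θ) →
      |∫ y, f (m + Q w' + y) * inner ℝ w y ∂ν - ∫ y, f (m + y) * inner ℝ w y ∂ν| ≤
        c₂ * (L * κ ^ (θ / 2)) * √(inner ℝ (Q w) w) * √(inner ℝ (Q w') w') := by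
  obtain ⟨c₀, hc₀, h0⟩ := exists_abs_integral_translate_sub_le
  obtain ⟨c₁, hc₁, h1⟩ := exists_abs_integral_mul_inner_le
  refine ⟨4 * c₀ * c₁, by positivity, ?_⟩
  intro H _ _ _ _ _ _ ν Q _ hν f S L θ κ m w w' hθ0 hθ1 hκ0 hκ hf hS hL0 hL
  have hsc : SecondCountableTopology H := UniformSpace.secondCountable_of_separable H
  -- Write `y = y₁ + y₂` with independent halves of law `η`. Averaging over the half that carries
  -- the weight produces a bounded function `g`, and the translation is then absorbed by the other
  -- half through the estimate for merely bounded functions.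
  set η := ν.map fun y : H => (√2)⁻¹ • y with hη
  have : IsProbabilityMeasure η := Measure.isProbabilityMeasure_map (by fun_prop)
  have hη' : IsCenteredGaussian η ((1 / 2 : ℝ) • Q) := hν.map_half
  set g : H → ℝ := fun x => ∫ y, f (x + y) * inner ℝ w y ∂η with hg
  have hgm : Measurable g := by
    refine StronglyMeasurable.measurable ?_
    refine StronglyMeasurable.integral_prod_right (f := fun x y : H =>
      f (x + y) * inner ℝ w y) ?_
    exact Measurable.stronglyMeasurable ((hf.comp measurable_add).mul (by fun_prop))
  have hgb : ∀ x, |g x| ≤ c₁ * (L * κ ^ (θ / 2)) * √(inner ℝ (Q w) w) := by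
    intro x
    refine (h1 hη' f S L θ κ x w hθ0 hθ1 hκ0 (fun x => ?_) hf hS hL0 hL).trans ?_
    · have := hκ x
      simp only [smul_apply, norm_smul, inner_smul_left, conj_trivial, mul_pow]
      norm_num
      nlinarith [sq_nonneg ‖Q x‖]
    · have hV : 0 ≤ inner ℝ (Q w) w := by
        by_cases h : w = 0
        · simp [h]
        · exact (hν.pos w h).le
      simp only [smul_apply, inner_smul_left, conj_trivial]
      gcongr
      linarith
  -- The weight is a sum over the two halves, which contribute equally by symmetry; hence the factor
  -- 2.
  have key : ∀ x, ∫ y, f (x + y) * inner ℝ w y ∂ν = 2 * ∫ y, g (x + y) ∂η := by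
    intro x
    have hm : Measurable (fun p : H × H => p.1 + p.2) := measurable_add
    have i0 := hν.integrable_mul_inner hf hS x w
    have hmap := hν.map_add_half
    rw [← hη] at hmap
    have i1 := i0
    rw [← hmap] at i1
    have fm : Measurable (fun p : H × H => f (x + (p.1 + p.2))) := hf.comp (by fun_prop)
    have i2 : Integrable (fun p : H × H => f (x + (p.1 + p.2)) * inner ℝ w p.1) (η.prod η) :=
      ((hη'.integrable_inner w).comp_fst η).bdd_mul fm.aestronglyMeasurable
        (Eventually.of_forall fun _ => hS _)
    have i3 : Integrable (fun p : H × H => f (x + (p.1 + p.2)) * inner ℝ w p.2) (η.prod η) :=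
      ((hη'.integrable_inner w).comp_snd η).bdd_mul fm.aestronglyMeasurable
        (Eventually.of_forall fun _ => hS _)
    have e1 : ∫ y, f (x + y) * inner ℝ w y ∂ν =
        ∫ p : H × H, f (x + (p.1 + p.2)) * inner ℝ w p.1 +
          f (x + (p.1 + p.2)) * inner ℝ w p.2 ∂(η.prod η) := by
      conv_lhs => rw [← hmap]
      rw [integral_map hm.aemeasurable i1.1]
      simp only [inner_add_right, mul_add]
    have e2 : ∫ p : H × H, f (x + (p.1 + p.2)) * inner ℝ w p.1 ∂(η.prod η) =
        ∫ p : H × H, f (x + (p.1 + p.2)) * inner ℝ w p.2 ∂(η.prod η) := by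
      rw [← integral_prod_swap]
      simp [add_comm]
    have e3 : ∫ p : H × H, f (x + (p.1 + p.2)) * inner ℝ w p.2 ∂(η.prod η) =
        ∫ y, g (x + y) ∂η := by
      rw [integral_prod _ i3]
      simp only [hg, add_assoc]
    rw [e1, integral_add i2 i3, e2, e3]
    ring
  rw [key, key, ← mul_sub, ← integral_sub (integrable_shift hgm hgb _) (integrable_shift hgm hgb _),
    abs_mul, abs_two]
  -- The covariance of `η` is `Q / 2`, so the shift `Q w'` is generated by `2 w'`. This costs a
  -- factor `√2 ≤ 2`, which together with the 2 from `key` explains the constant `4 c₀ c₁`.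
  have h2 := h0 hη' g _ m ((2 : ℝ) • w') hgm hgb
  have e4 : ((1 / 2 : ℝ) • Q) ((2 : ℝ) • w') = Q w' := by
    simp [smul_smul]
  rw [e4, inner_smul_right, Real.sqrt_mul (by norm_num)] at h2
  have h3 : √2 ≤ (2 : ℝ) := by
    rw [Real.sqrt_le_left (by norm_num)]; norm_num
  refine (mul_le_mul_of_nonneg_left h2 (by norm_num)).trans ?_
  have h5 : 0 ≤ c₀ * (c₁ * (L * κ ^ (θ / 2)) * √(inner ℝ (Q w) w)) * √(inner ℝ (Q w') w') := by
    positivity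
  nlinarith

end AbstractGaussian

/-! ### Operators diagonal in an orthonormal basis -/

section Diagonal

variable {H : Type*} [NormedAddCommGroup H] [InnerProductSpace ℝ H] (e : HilbertBasis ℕ ℝ H)

theorem hasSum_inner_sq (x : H) : HasSum (fun k => inner ℝ (e k) x ^ 2) (‖x‖ ^ 2) := by
  have h := e.hasSum_inner_mul_inner x x
  rw [real_inner_self_eq_norm_sq] at h
  refine h.congr_fun fun k => ?_
  rw [real_inner_comm, sq]

theorem ext_inner_basis {x y : H} (h : ∀ k, inner ℝ (e k) x = inner ℝ (e k) y) : x = y := by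
  apply e.repr.injective
  ext k
  rw [e.repr_apply_apply, e.repr_apply_apply, h]

theorem memℓp_mul_inner {b : ℕ → ℝ} {C : ℝ} (hb : ∀ k, |b k| ≤ C) (x : H) :
    Memℓp (fun k => b k * inner ℝ (e k) x) 2 := by
  have hC : 0 ≤ C := (abs_nonneg _).trans (hb 0)
  have h := (lp.memℓp (e.repr x)).const_smul C
  refine memℓp_gen ?_
  have h2 := h.summable (by norm_num)
  refine Summable.of_nonneg_of_le (fun k => by positivity) (fun k => ?_) h2
  gcongr
  simp only [Pi.smul_apply, norm_mul, smul_eq_mul, e.repr_apply_apply]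
  gcongr
  rw [Real.norm_eq_abs, Real.norm_of_nonneg hC]
  exact hb k

open scoped Classical in
/-- The bounded operator which is diagonal in the basis `e`, with eigenvalues `b` (zero if `b` is
not bounded). -/
noncomputable def diagonal (b : ℕ → ℝ) : H →L[ℝ] H :=
  if h : ∃ C : ℝ, ∀ k, |b k| ≤ C then
    LinearMap.mkContinuous
      { toFun := fun x => e.repr.symm ⟨fun k => b k * inner ℝ (e k) x,
          memℓp_mul_inner e h.choose_spec x⟩
        map_add' := fun x y => ext_inner_basis e fun k => by
          simp [← e.repr_apply_apply, mul_add]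
          rfl
        map_smul' := fun c x => ext_inner_basis e fun k => by
          simp [← e.repr_apply_apply, mul_left_comm] } h.choose
      (fun x => by
        have hC : 0 ≤ h.choose := (abs_nonneg _).trans (h.choose_spec 0)
        refine le_of_sq_le_sq ?_ (by positivity)
        rw [mul_pow]
        refine hasSum_le (fun k => ?_) (hasSum_inner_sq e _)
          ((hasSum_inner_sq e x).mul_left (h.choose ^ 2))
        simp only [LinearMap.coe_mk, AddHom.coe_mk, ← e.repr_apply_apply,
          LinearIsometryEquiv.apply_symm_apply, mul_pow]
        exact mul_le_mul_of_nonneg_right (sq_le_sq.2 ((h.choose_spec k).trans (le_abs_self _)))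
          (sq_nonneg _))
  else 0

variable {e} {b : ℕ → ℝ} {C : ℝ}

theorem inner_diagonal (hb : ∀ k, |b k| ≤ C) (k : ℕ) (x : H) :
    inner ℝ (e k) (diagonal e b x) = b k * inner ℝ (e k) x := by
  have h : ∃ C : ℝ, ∀ k, |b k| ≤ C := ⟨C, hb⟩
  rw [diagonal, dif_pos h, LinearMap.mkContinuous_apply]
  simp [← e.repr_apply_apply]

theorem hasSum_diagonal (hb : ∀ k, |b k| ≤ C) (x : H) :
    HasSum (fun k => (b k * inner ℝ (e k) x) • e k) (diagonal e b x) := by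
  have h := e.hasSum_repr (diagonal e b x)
  refine h.congr_fun fun k => ?_
  rw [e.repr_apply_apply, inner_diagonal hb]

theorem hasSum_inner_diagonal (hb : ∀ k, |b k| ≤ C) (x y : H) :
    HasSum (fun k => b k * inner ℝ (e k) x * inner ℝ (e k) y) (inner ℝ (diagonal e b x) y) := by
  have h := e.hasSum_inner_mul_inner (diagonal e b x) y
  refine h.congr_fun fun k => ?_
  rw [real_inner_comm (e k) (diagonal e b x), inner_diagonal hb]

theorem diagonal_symm (hb : ∀ k, |b k| ≤ C) (x y : H) :
    inner ℝ (diagonal e b x) y = inner ℝ x (diagonal e b y) := by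
  refine (hasSum_inner_diagonal hb x y).unique ?_
  rw [real_inner_comm]
  refine (hasSum_inner_diagonal hb y x).congr_fun fun k => ?_
  ring

theorem hasSum_norm_sq_diagonal (hb : ∀ k, |b k| ≤ C) (x : H) :
    HasSum (fun k => b k ^ 2 * inner ℝ (e k) x ^ 2) (‖diagonal e b x‖ ^ 2) := by
  refine (hasSum_inner_sq e (diagonal e b x)).congr_fun fun k => ?_
  rw [inner_diagonal hb, mul_pow]

theorem norm_diagonal_le (hb : ∀ k, |b k| ≤ C) (x : H) : ‖diagonal e b x‖ ≤ C * ‖x‖ := by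
  have hC : 0 ≤ C := (abs_nonneg _).trans (hb 0)
  refine le_of_sq_le_sq ?_ (by positivity)
  rw [mul_pow]
  refine hasSum_le (fun k => ?_) (hasSum_norm_sq_diagonal hb x)
    ((hasSum_inner_sq e x).mul_left (C ^ 2))
  exact mul_le_mul_of_nonneg_right (sq_le_sq.2 ((hb k).trans (le_abs_self _))) (sq_nonneg _)

end Diagonal

/-! ### The Gaussian series: convergence, characteristic function, parameter dependence -/

section Series

variable {H : Type*} [NormedAddCommGroup H] [InnerProductSpace ℝ H]
  [MeasurableSpace H] [CompleteSpace H] [TopologicalSpace.SeparableSpace H] [BorelSpace H]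
  {e : HilbertBasis ℕ ℝ H} {q : ℕ → ℝ≥0}

theorem lintegral_ofReal_sq_gaussianReal (v : ℝ≥0) :
    ∫⁻ s, ENNReal.ofReal (s ^ 2) ∂gaussianReal 0 v = v := by
  have h1 : Integrable (fun s : ℝ => s ^ 2) (gaussianReal 0 v) :=
    (memLp_id_gaussianReal 2).integrable_sq
  rw [← ofReal_integral_eq_lintegral_ofReal h1 (Eventually.of_forall fun s => sq_nonneg s)]
  have h2 := variance_fun_id_gaussianReal (μ := 0) (v := v)
  rw [variance_eq_integral (by fun_prop)] at h2
  simp only [integral_id_gaussianReal, sub_zero] at h2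
  rw [h2, ENNReal.ofReal_coe_nnreal]

/-- The expectation of `∑ ξₖ²` is `∑ qₖ < ∞`, so the sum is almost surely finite, and for
orthonormal vectors this is summability of the series. -/
theorem ae_summable_gaussianSeries (hq : Summable q) :
    ∀ᵐ ξ ∂Measure.infinitePi fun k => gaussianReal 0 (q k), Summable fun k => ξ k • e k := by
  have h1 : ∫⁻ ξ, ∑' k, ENNReal.ofReal (ξ k ^ 2) ∂(Measure.infinitePi fun k =>
      gaussianReal 0 (q k)) = ∑' k, (q k : ℝ≥0∞) := by
    rw [lintegral_tsum fun k => Measurable.aemeasurable (by fun_prop)]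
    congr 1 with k
    rw [← lintegral_ofReal_sq_gaussianReal (q k),
      ← Measure.infinitePi_map_eval (fun k => gaussianReal 0 (q k)) k,
      lintegral_map (by fun_prop) (by fun_prop)]
  have h2 := ae_lt_top' (μ := Measure.infinitePi fun k => gaussianReal 0 (q k))
    (f := fun ξ => ∑' k, ENNReal.ofReal (ξ k ^ 2))
    (AEMeasurable.tsum fun k => Measurable.aemeasurable (by fun_prop)) (by
      rw [h1]; exact ENNReal.tsum_coe_ne_top_iff_summable.2 hq)
  filter_upwards [h2] with ξ hξ
  have h3 := e.orthonormal.orthogonalFamily.summable_iff_norm_sq_summable ξ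
  simp only [LinearIsometry.toSpanSingleton_apply, Real.norm_eq_abs, sq_abs] at h3
  rw [h3]
  simpa [ENNReal.toReal_ofReal, sq_nonneg] using ENNReal.summable_toReal hξ.ne

theorem integral_exp_finset_sum_infinitePi (q : ℕ → ℝ≥0) (c : ℕ → ℝ) (s : Finset ℕ) :
    ∫ ξ, Complex.exp (((∑ k ∈ s, ξ k * c k : ℝ) : ℂ) * Complex.I)
      ∂(Measure.infinitePi fun k => gaussianReal 0 (q k)) =
      Complex.exp ((-((∑ k ∈ s, q k * c k * c k) / 2) : ℝ) : ℂ) := by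
  set μ := Measure.infinitePi fun k => gaussianReal 0 (q k)
  have hind : iIndepFun (fun k (ξ : ℕ → ℝ) => ξ k * c k) μ :=
    iIndepFun_infinitePi (P := fun k => gaussianReal 0 (q k)) (X := fun k (x : ℝ) => x * c k)
      fun k => by fun_prop
  have h1 := congrFun ((hind.restrict s).charFun_map_fun_finsetSum_eq_prod
    (fun k _ => Measurable.aemeasurable (by fun_prop))) 1
  rw [charFun_apply, integral_map (Measurable.aemeasurable (by fun_prop)) (by fun_prop),
    Finset.prod_apply] at h1
  have h2 : ∀ k, charFun (μ.map fun ξ : ℕ → ℝ => ξ k * c k) 1 =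
      Complex.exp ((-((q k * c k * c k) / 2) : ℝ) : ℂ) := by
    intro k
    have h3 : (μ.map fun ξ : ℕ → ℝ => ξ k * c k) =
        (gaussianReal 0 (q k)).map (fun x => c k * x) := by
      rw [← Measure.infinitePi_map_eval (fun k => gaussianReal 0 (q k)) k,
        Measure.map_map (by fun_prop) (by fun_prop)]
      congr 1 with ξ
      simp [mul_comm]
    rw [h3, charFun_map_mul, charFun_gaussianReal]
    congr 1
    push_cast
    ring
  simp_rw [h2] at h1
  rw [← Complex.exp_sum] at h1
  convert h1 using 1
  · simp
  · congr 1
    rw [← Complex.ofReal_sum]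
    congr 1
    rw [Finset.sum_neg_distrib, Finset.sum_div]

/-- By independence the characteristic functions of the partial sums are explicit; almost sure
convergence and the bound 1 allow passage to the limit. Positive definiteness holds because a
nonzero vector has a nonzero coordinate and every `qₖ` is positive. -/
theorem isCenteredGaussian_gaussianMeasure (hq : Summable q) (hpos : ∀ k, 0 < q k) :
    IsCenteredGaussian (gaussianMeasure e q) (diagonal e fun k => (q k : ℝ)) := by
  obtain ⟨C, hC⟩ : ∃ C : ℝ, ∀ k, |(q k : ℝ)| ≤ C :=
    ⟨∑' k, (q k : ℝ), fun k => by
      rw [NNReal.abs_eq]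
      exact (NNReal.summable_coe.2 hq).le_tsum k fun j _ => (q j).2⟩
  refine ⟨diagonal_symm hC, fun x hx => ?_, fun h => ?_⟩
  · have h1 := hasSum_inner_diagonal (e := e) hC x x
    have h0 : ∀ k, 0 ≤ (q k : ℝ) * inner ℝ (e k) x * inner ℝ (e k) x := fun k => by
      rw [mul_assoc]; exact mul_nonneg (q k).2 (mul_self_nonneg _)
    obtain ⟨k, hk⟩ : ∃ k, inner ℝ (e k) x ≠ 0 := by
      by_contra! h
      exact hx (ext_inner_basis e fun k => by rw [h, inner_zero_right])
    refine lt_of_lt_of_le ?_ (h1.summable.le_tsum k fun j _ => h0 j |>.trans le_rfl) |>.trans_eq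
      h1.tsum_eq
    rw [mul_assoc]
    exact mul_pos (hpos k) (mul_self_pos.2 hk)
  · set μ := Measure.infinitePi fun k => gaussianReal 0 (q k) with hμ
    rw [charFun_apply, gaussianMeasure,
      integral_map (measurable_gaussianSeries e).aemeasurable (by fun_prop)]
    have h1 : Tendsto (fun n => ∫ ξ, Complex.exp (((∑ k ∈ Finset.range n,
        ξ k * inner ℝ (e k) h : ℝ) : ℂ) * Complex.I) ∂μ) atTop
        (𝓝 (∫ ξ, Complex.exp ((inner ℝ (∑' k, ξ k • e k) h : ℝ) * Complex.I) ∂μ)) := by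
      refine tendsto_integral_of_dominated_convergence (fun _ => 1) (fun n => ?_)
        (integrable_const 1) (fun n => ?_) ?_
      · exact Measurable.aestronglyMeasurable (by fun_prop)
      · exact Eventually.of_forall fun ξ => by rw [Complex.norm_exp_ofReal_mul_I]
      · filter_upwards [ae_summable_gaussianSeries (e := e) hq] with ξ hξ
        have h2 := ((innerSL ℝ h).hasSum hξ.hasSum).tendsto_sum_nat
        have h3 : Continuous fun a : ℝ => Complex.exp (a * Complex.I) := by fun_prop
        have h4 := (h3.tendsto _).comp h2
        rw [innerSL_apply_apply, real_inner_comm] at h4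
        refine h4.congr fun n => ?_
        simp only [Function.comp, innerSL_apply_apply, inner_smul_right, real_inner_comm h]
    refine tendsto_nhds_unique h1 ?_
    simp_rw [hμ, integral_exp_finset_sum_infinitePi]
    have h2 := (hasSum_inner_diagonal (e := e) hC h h).tendsto_sum_nat
    have h3 : Continuous fun a : ℝ => Complex.exp ((-(a / 2) : ℝ) : ℂ) := by fun_prop
    exact (h3.tendsto _).comp h2

/-- Rescaling the coordinates moves the dependence on `q` from the measure into the integrand, so
that measurability in a parameter follows from Fubini over one fixed measure. -/
theorem gaussianMeasure_eq_map (e : HilbertBasis ℕ ℝ H) (q : ℕ → ℝ≥0) :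
    gaussianMeasure e q = (Measure.infinitePi fun _ : ℕ => gaussianReal 0 1).map
      fun ξ => ∑' k, (√(q k) * ξ k) • e k := by
  have h1 : (fun k => gaussianReal 0 (q k)) =
      fun k => (gaussianReal 0 1).map (fun x => √(q k : ℝ) * x) := by
    funext k
    rw [gaussianReal_map_const_mul]
    congr 1
    · simp
    · ext
      simp
  rw [gaussianMeasure, h1, ← Measure.infinitePi_map_pi (fun _ : ℕ => gaussianReal 0 1)
    (fun k => by fun_prop), Measure.map_map (measurable_gaussianSeries e) (by fun_prop)]
  rfl

/-- Measurable dependence on a parameter of integrals against Gaussian measures. -/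
theorem stronglyMeasurable_integral_gaussianMeasure {E : Type*} [NormedAddCommGroup E]
    [NormedSpace ℝ E] {q : ℝ → ℕ → ℝ≥0} (hq : ∀ k, Measurable fun t => q t k)
    {F : ℝ → H → E} (hF : StronglyMeasurable (Function.uncurry F)) :
    StronglyMeasurable fun t => ∫ y, F t y ∂gaussianMeasure e (q t) := by
  have hm : Measurable fun p : ℝ × (ℕ → ℝ) => ∑' k, (√(q p.1 k) * p.2 k) • e k := by
    refine (measurable_gaussianSeries e).comp (measurable_pi_lambda _ fun k => ?_)
    have := hq k
    fun_prop
  have h1 : (fun t => ∫ y, F t y ∂gaussianMeasure e (q t)) = fun t =>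
      ∫ ξ, F t (∑' k, (√(q t k) * ξ k) • e k)
        ∂(Measure.infinitePi fun _ : ℕ => gaussianReal 0 1) := by
    funext t
    rw [gaussianMeasure_eq_map, integral_map]
    · exact (hm.comp measurable_prodMk_left).aemeasurable
    · exact (hF.comp_measurable measurable_prodMk_left).aestronglyMeasurable
  rw [h1]
  refine StronglyMeasurable.integral_prod_right (f := fun (t : ℝ) (ξ : ℕ → ℝ) =>
    F t (∑' k, (√(q t k) * ξ k) • e k)) ?_
  exact hF.comp_measurable (measurable_fst.prodMk hm)

end Series

/-! ### Eigenvalues of `-A`, `Qₜ` and `Qₜ⁻¹ e^{tA}` -/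

section Spectrum

variable {H : Type*} [NormedAddCommGroup H] [InnerProductSpace ℝ H]

/-- The properties of the eigenvalues of `-A` used below: a positive lower bound and summable
inverses. -/
structure IsSpectralSequence (ω : ℝ) (lam : ℕ → ℝ) : Prop where
  pos : 0 < ω
  le : ∀ k, ω ≤ lam k
  summable : Summable fun k => (lam k)⁻¹

/-- For each rank-one term, Cauchy–Schwarz and Bessel give `∑ₖ |⟨aₙ, eₖ⟩ ⟨bₙ, eₖ⟩| ≤ ‖aₙ‖ ‖bₙ‖`;
then sum over `n`. -/
theorem IsTraceClass.summable_abs_inner {T : H →L[ℝ] H} (hT : IsTraceClass T)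
    (e : HilbertBasis ℕ ℝ H) : Summable fun k => |inner ℝ (T (e k)) (e k)| := by
  obtain ⟨a, b, hs, hab⟩ := hT
  have h1 : ∀ k, HasSum (fun n => inner ℝ (a n) (e k) * inner ℝ (b n) (e k))
      (inner ℝ (T (e k)) (e k)) := by
    intro k
    have h := (innerSL ℝ (e k)).hasSum (hab (e k))
    rw [innerSL_apply_apply, real_inner_comm] at h
    refine h.congr_fun fun n => ?_
    rw [innerSL_apply_apply, inner_smul_right, real_inner_comm (e k) (b n)]
  have hn : ∀ k n, |inner ℝ (a n) (e k) * inner ℝ (b n) (e k)| ≤ ‖a n‖ * ‖b n‖ := by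
    intro k n
    rw [abs_mul]
    have h2 := abs_real_inner_le_norm (a n) (e k)
    have h3 := abs_real_inner_le_norm (b n) (e k)
    rw [e.orthonormal.1, mul_one] at h2 h3
    gcongr
  have hsum : ∀ k, Summable fun n => |inner ℝ (a n) (e k) * inner ℝ (b n) (e k)| := fun k =>
    Summable.of_nonneg_of_le (fun _ => abs_nonneg _) (hn k) hs
  have hbes : ∀ (x : H) (s : Finset ℕ), ∑ k ∈ s, inner ℝ x (e k) ^ 2 ≤ ‖x‖ ^ 2 := by
    intro x s
    have h := sum_le_hasSum s (fun k _ => sq_nonneg _) (hasSum_inner_sq e x)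
    simpa only [real_inner_comm x] using h
  have hfin : ∀ s : Finset ℕ, ∑ k ∈ s, |inner ℝ (T (e k)) (e k)| ≤ ∑' n, ‖a n‖ * ‖b n‖ := by
    intro s
    have h2 : ∀ k ∈ s, |inner ℝ (T (e k)) (e k)| ≤
        ∑' n, |inner ℝ (a n) (e k) * inner ℝ (b n) (e k)| := by
      intro k _
      rw [← (h1 k).tsum_eq]
      have h4 : Summable fun n => ‖inner ℝ (a n) (e k) * inner ℝ (b n) (e k)‖ := by
        simpa only [Real.norm_eq_abs] using hsum k
      simpa only [Real.norm_eq_abs] using norm_tsum_le_tsum_norm h4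
    have h3 : ∀ n, ∑ k ∈ s, |inner ℝ (a n) (e k) * inner ℝ (b n) (e k)| ≤ ‖a n‖ * ‖b n‖ := by
      intro n
      refine le_of_sq_le_sq ?_ (mul_nonneg (norm_nonneg _) (norm_nonneg _))
      simp_rw [abs_mul]
      refine (Finset.sum_mul_sq_le_sq_mul_sq s _ _).trans ?_
      simp_rw [sq_abs]
      rw [mul_pow]
      exact mul_le_mul (hbes _ _) (hbes _ _) (Finset.sum_nonneg fun _ _ => sq_nonneg _)
        (sq_nonneg _)
    refine (Finset.sum_le_sum h2).trans ?_
    rw [← Summable.tsum_finsetSum fun k _ => hsum k]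
    exact Summable.tsum_le_tsum h3 (summable_sum fun k _ => hsum k) hs
  exact summable_of_sum_le (fun _ => abs_nonneg _) hfin

/-- The inverse satisfies `A⁻¹ eₖ = -λₖ⁻¹ eₖ`, so summability of `λₖ⁻¹` is summability of its
diagonal entries; negative definiteness tested on `eₖ` gives the lower bound. -/
theorem IsAdmissible.isSpectralSequence [CompleteSpace H] {A : H →ₗ.[ℝ] H} (hA : IsAdmissible A)
    {e : HilbertBasis ℕ ℝ H} {lam : ℕ → ℝ} (he : IsEigenbasis A e lam) :
    ∃ ω, IsSpectralSequence ω lam := by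
  obtain ⟨ω, hω, hneg⟩ := hA.negDef
  obtain ⟨T, hT, htr⟩ := hA.traceClassInv
  have hle : ∀ k, ω ≤ lam k := by
    intro k
    obtain ⟨h, h'⟩ := he k
    have h1 := hneg ⟨e k, h⟩
    rw [h'] at h1
    simp only [inner_smul_left, real_inner_self_eq_norm_sq, e.orthonormal.1] at h1
    simp at h1
    linarith
  refine ⟨ω, hω, hle, (htr.summable_abs_inner e).congr fun k => ?_⟩
  obtain ⟨h, h'⟩ := he k
  have hk : 0 < lam k := hω.trans_le (hle k)
  have h1 := hT.2 ⟨e k, h⟩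
  rw [h', map_smul] at h1
  have h2 : inner ℝ (T (e k)) (e k) = -(lam k)⁻¹ := by
    have h3 := congrArg (fun x => inner ℝ x (e k)) h1
    simp only [inner_smul_left, real_inner_self_eq_norm_sq, e.orthonormal.1] at h3
    simp only [conj_trivial, one_pow] at h3
    field_simp
    linarith
  rw [h2, abs_neg, abs_of_pos (inv_pos.2 hk)]

variable {ω : ℝ} {lam : ℕ → ℝ} {t : ℝ}

theorem IsSpectralSequence.lam_pos (h : IsSpectralSequence ω lam) (k : ℕ) : 0 < lam k :=
  h.pos.trans_le (h.le k)

theorem one_sub_exp_pos (h : IsSpectralSequence ω lam) (ht : 0 < t) (k : ℕ) :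
    0 < 1 - Real.exp (-2 * lam k * t) := by
  have : -2 * lam k * t < 0 := by nlinarith [mul_pos (h.lam_pos k) ht]
  linarith [Real.exp_lt_exp.2 this, Real.exp_zero]

theorem coe_covEigenvalue (h : IsSpectralSequence ω lam) (ht : 0 < t) (k : ℕ) :
    (covEigenvalue lam t k : ℝ) = (1 - Real.exp (-2 * lam k * t)) / (2 * lam k) :=
  Real.coe_toNNReal _ (div_nonneg (one_sub_exp_pos h ht k).le (by linarith [h.lam_pos k]))

theorem covEigenvalue_pos (h : IsSpectralSequence ω lam) (ht : 0 < t) (k : ℕ) :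
    0 < covEigenvalue lam t k := by
  rw [← NNReal.coe_pos, coe_covEigenvalue h ht]
  exact div_pos (one_sub_exp_pos h ht k) (by linarith [h.lam_pos k])

theorem covEigenvalue_le (h : IsSpectralSequence ω lam) (ht : 0 < t) (k : ℕ) :
    (covEigenvalue lam t k : ℝ) ≤ t := by
  have hk := h.lam_pos k
  rw [coe_covEigenvalue h ht, div_le_iff₀ (by linarith)]
  nlinarith [Real.add_one_le_exp (-2 * lam k * t)]

theorem summable_covEigenvalue (h : IsSpectralSequence ω lam) (ht : 0 < t) :
    Summable (covEigenvalue lam t) := by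
  rw [← NNReal.summable_coe]
  refine Summable.of_nonneg_of_le (fun _ => NNReal.coe_nonneg _) (fun k => ?_) h.summable
  have hk := h.lam_pos k
  rw [coe_covEigenvalue h ht, div_le_iff₀ (by linarith)]
  have := Real.exp_pos (-2 * lam k * t)
  rw [show (lam k)⁻¹ * (2 * lam k) = 2 by field_simp]
  linarith

/-- The eigenvalues of `Qₜ⁻¹ e^{tA}`. -/
noncomputable def smoothingCoeff (lam : ℕ → ℝ) (t : ℝ) (k : ℕ) : ℝ :=
  Real.exp (-lam k * t) / covEigenvalue lam t k

theorem smoothingCoeff_nonneg (k : ℕ) : 0 ≤ smoothingCoeff lam t k :=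
  div_nonneg (Real.exp_pos _).le (NNReal.coe_nonneg _)

theorem covEigenvalue_mul_smoothingCoeff (h : IsSpectralSequence ω lam) (ht : 0 < t) (k : ℕ) :
    covEigenvalue lam t k * smoothingCoeff lam t k = Real.exp (-lam k * t) := by
  have := (NNReal.coe_pos.2 (covEigenvalue_pos h ht k)).ne'
  rw [smoothingCoeff]
  field_simp

theorem covEigenvalue_mul_smoothingCoeff_sq (h : IsSpectralSequence ω lam) (ht : 0 < t) (k : ℕ) :
    covEigenvalue lam t k * smoothingCoeff lam t k ^ 2 =
      2 * lam k / (Real.exp (2 * (lam k * t)) - 1) := by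
  have hk := h.lam_pos k
  have h1 := one_sub_exp_pos h ht k
  have h2 : 0 < Real.exp (2 * (lam k * t)) - 1 := by
    have : 0 < 2 * (lam k * t) := by positivity
    linarith [Real.one_lt_exp_iff.2 this]
  have h3 : Real.exp (-2 * lam k * t) * Real.exp (2 * (lam k * t)) = 1 := by
    rw [← Real.exp_add, show -2 * lam k * t + 2 * (lam k * t) = 0 by ring, Real.exp_zero]
  have h4 : Real.exp (-lam k * t) ^ 2 = Real.exp (-2 * lam k * t) := by
    rw [sq, ← Real.exp_add]; congr 1; ring
  rw [sq, ← mul_assoc, covEigenvalue_mul_smoothingCoeff h ht, smoothingCoeff,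
    coe_covEigenvalue h ht, div_div_eq_mul_div, ← mul_div_assoc, ← mul_assoc, ← sq, h4,
    div_eq_div_iff h1.ne' h2.ne']
  linear_combination 2 * lam k * h3

/-- The left side is an eigenvalue of the square of `Qₜ^{-1/2} e^{tA}`, equal to `2λ / (e^{2λt} -
1)`; use `e^x - 1 ≥ x`. -/
theorem covEigenvalue_mul_smoothingCoeff_sq_le (h : IsSpectralSequence ω lam) (ht : 0 < t)
    (k : ℕ) : covEigenvalue lam t k * smoothingCoeff lam t k ^ 2 ≤ 1 / t := by
  have hk := h.lam_pos k
  have h0 : 0 < 2 * (lam k * t) := by positivity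
  have h1 := Real.add_one_le_exp (2 * (lam k * t))
  rw [covEigenvalue_mul_smoothingCoeff_sq h ht, div_le_div_iff₀ (by linarith) ht]
  linarith

/-- The same quantity times `λ`, bounded through `e^x - 1 ≥ x² / 2`. The factor `(-A)^{1/2}` thus
costs `t^{-1/2}`, uniformly in the spectrum. -/
theorem lam_mul_covEigenvalue_mul_smoothingCoeff_sq_le (h : IsSpectralSequence ω lam) (ht : 0 < t)
    (k : ℕ) : covEigenvalue lam t k * (√(lam k) * smoothingCoeff lam t k) ^ 2 ≤ 1 / t ^ 2 := by
  have hk := h.lam_pos k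
  have h0 : 0 < 2 * (lam k * t) := by positivity
  have h1 := Real.quadratic_le_exp_of_nonneg h0.le
  rw [mul_pow, Real.sq_sqrt hk.le, mul_left_comm, covEigenvalue_mul_smoothingCoeff_sq h ht,
    ← mul_div_assoc, div_le_div_iff₀ (by nlinarith) (by positivity)]
  nlinarith

/-- Needed only so that the diagonal operators are bounded. Its value, which may depend on `ω` and
`t`, never enters the final estimates. -/
theorem exists_smoothingCoeff_le (h : IsSpectralSequence ω lam) (ht : 0 < t) :
    ∃ C : ℝ, ∀ k, |smoothingCoeff lam t k| ≤ C ∧ |√(lam k) * smoothingCoeff lam t k| ≤ C := by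
  have hω := h.pos
  have hc : 0 < 1 - Real.exp (-2 * ω * t) := by
    have : -2 * ω * t < 0 := by nlinarith [mul_pos hω ht]
    linarith [Real.exp_lt_exp.2 this, Real.exp_zero]
  -- Both claims at once: `g` will be 1 and then `√λₖ`.
  have key : ∀ k, ∀ g : ℝ, 0 ≤ g → g * lam k ≤ 1 + lam k ^ 2 → |g * smoothingCoeff lam t k| ≤
      2 * (1 + 2 / t ^ 2) / (1 - Real.exp (-2 * ω * t)) := by
    intro k g hg hgl
    have hk := h.lam_pos k
    have h1 := one_sub_exp_pos h ht k
    rw [abs_of_nonneg (mul_nonneg hg (smoothingCoeff_nonneg k)), smoothingCoeff,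
      coe_covEigenvalue h ht, div_div_eq_mul_div, ← mul_div_assoc]
    have h2 : Real.exp (-2 * lam k * t) ≤ Real.exp (-2 * ω * t) := by
      apply Real.exp_le_exp.2
      nlinarith [mul_le_mul_of_nonneg_right (h.le k) ht.le]
    have h3 := Real.quadratic_le_exp_of_nonneg (mul_pos hk ht).le
    have h4 : Real.exp (-lam k * t) * Real.exp (lam k * t) = 1 := by
      rw [← Real.exp_add, show -lam k * t + lam k * t = 0 by ring, Real.exp_zero]
    have h5 : 1 + lam k ^ 2 ≤ (1 + 2 / t ^ 2) * Real.exp (lam k * t) := by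
      have : 1 + lam k ^ 2 ≤ (1 + 2 / t ^ 2) * (1 + (lam k * t) ^ 2 / 2) := by
        have : (1 + 2 / t ^ 2) * (1 + (lam k * t) ^ 2 / 2) =
          1 + lam k ^ 2 + 2 / t ^ 2 + (lam k * t) ^ 2 / 2 := by field_simp; ring
        rw [this]
        have : 0 ≤ 2 / t ^ 2 + (lam k * t) ^ 2 / 2 := by positivity
        linarith
      refine this.trans ?_
      gcongr
      nlinarith [mul_pos hk ht]
    gcongr ?_ / ?_
    · calc g * (Real.exp (-lam k * t) * (2 * lam k))
          = 2 * Real.exp (-lam k * t) * (g * lam k) := by ring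
        _ ≤ 2 * Real.exp (-lam k * t) * ((1 + 2 / t ^ 2) * Real.exp (lam k * t)) := by
            exact mul_le_mul_of_nonneg_left (hgl.trans h5) (by positivity)
        _ = 2 * (1 + 2 / t ^ 2) * (Real.exp (-lam k * t) * Real.exp (lam k * t)) := by ring
        _ = _ := by rw [h4, mul_one]
    · linarith
  refine ⟨_, fun k => ⟨?_, key k (√(lam k)) (Real.sqrt_nonneg _) ?_⟩⟩
  · have h1 := key k 1 zero_le_one (by nlinarith [sq_nonneg (lam k - 1)])
    rwa [one_mul] at h1
  · have hk := h.lam_pos k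
    have h1 := Real.sq_sqrt hk.le
    have h2 := sq_nonneg (√(lam k) - 1)
    nlinarith [mul_nonneg hk.le h2, sq_nonneg (lam k - 1)]

end Spectrum

/-! ### The semigroup and the Cameron–Martin space of `N(0, Qₜ)` -/

section Semigroup

variable {H : Type*} [NormedAddCommGroup H] [InnerProductSpace ℝ H]
  {e : HilbertBasis ℕ ℝ H} {ω : ℝ} {lam : ℕ → ℝ} {t : ℝ}

theorem abs_exp_neg_le (h : IsSpectralSequence ω lam) (ht : 0 < t) (k : ℕ) :
    |Real.exp (-lam k * t)| ≤ 1 := by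
  rw [Real.abs_exp, Real.exp_le_one_iff]
  nlinarith [mul_pos (h.lam_pos k) ht]

theorem abs_covEigenvalue_le (h : IsSpectralSequence ω lam) (ht : 0 < t) (k : ℕ) :
    |(covEigenvalue lam t k : ℝ)| ≤ t := by
  rw [NNReal.abs_eq]
  exact covEigenvalue_le h ht k

theorem abs_inv_sqrt_le (h : IsSpectralSequence ω lam) (k : ℕ) : |(√(lam k))⁻¹| ≤ (√ω)⁻¹ := by
  rw [abs_of_nonneg (by positivity)]
  have := Real.sqrt_pos.2 h.pos
  gcongr
  exact h.le k

theorem semigroup_eq_diagonal (h : IsSpectralSequence ω lam) (ht : 0 < t) (x : H) :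
    semigroup e lam t x = diagonal e (fun k => Real.exp (-lam k * t)) x :=
  (hasSum_diagonal (abs_exp_neg_le h ht) x).tsum_eq

/-- Since `e^{tA} = Qₜ (Qₜ⁻¹ e^{tA})`, every increment of the initial point becomes a shift of the
form `Q w`, to which the abstract estimates apply. -/
theorem semigroup_add (h : IsSpectralSequence ω lam) (ht : 0 < t) (x g : H) :
    semigroup e lam t (x + g) = semigroup e lam t x +
      diagonal e (fun k => (covEigenvalue lam t k : ℝ)) (diagonal e (smoothingCoeff lam t) g) := by
  obtain ⟨C, hC⟩ := exists_smoothingCoeff_le h ht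
  rw [semigroup_eq_diagonal h ht, semigroup_eq_diagonal h ht, map_add]
  congr 1
  refine ext_inner_basis e fun k => ?_
  rw [inner_diagonal (abs_exp_neg_le h ht), inner_diagonal (abs_covEigenvalue_le h ht),
    inner_diagonal fun k => (hC k).1, ← mul_assoc, covEigenvalue_mul_smoothingCoeff h ht]

/-- All eigenvalues of `Qₜ` are at most `t`, so the abstract estimates hold with `κ = t`. -/
theorem norm_sq_covariance_le (h : IsSpectralSequence ω lam) (ht : 0 < t) (x : H) :
    ‖diagonal e (fun k => (covEigenvalue lam t k : ℝ)) x‖ ^ 2 ≤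
      t * inner ℝ (diagonal e (fun k => (covEigenvalue lam t k : ℝ)) x) x := by
  refine hasSum_le (fun k => ?_) (hasSum_norm_sq_diagonal (abs_covEigenvalue_le h ht) x)
    ((hasSum_inner_diagonal (abs_covEigenvalue_le h ht) x x).mul_left t)
  have h1 := covEigenvalue_le h ht k
  have h2 := NNReal.coe_nonneg (covEigenvalue lam t k)
  nlinarith [mul_le_mul_of_nonneg_right h1 (mul_nonneg h2 (sq_nonneg (inner ℝ (e k) x)))]

theorem inner_covariance_diagonal_le (h : IsSpectralSequence ω lam) (ht : 0 < t) {b : ℕ → ℝ}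
    {C M : ℝ} (hb : ∀ k, |b k| ≤ C) (hM : ∀ k, covEigenvalue lam t k * b k ^ 2 ≤ M) (x : H) :
    inner ℝ (diagonal e (fun k => (covEigenvalue lam t k : ℝ)) (diagonal e b x))
      (diagonal e b x) ≤ M * ‖x‖ ^ 2 := by
  refine hasSum_le (fun k => ?_) (hasSum_inner_diagonal (abs_covEigenvalue_le h ht) _ _)
    ((hasSum_inner_sq e x).mul_left M)
  rw [inner_diagonal hb]
  have := mul_le_mul_of_nonneg_right (hM k) (sq_nonneg (inner ℝ (e k) x))
  linarith

end Semigroup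

/-! ### Smoothing estimates for `Pₜ` -/

section Kernel

variable {H : Type*} [NormedAddCommGroup H] [InnerProductSpace ℝ H]

/-- `f` is continuous, bounded by `S` and `θ`-Hölder with constant `L`. -/
structure IsHolderBounded (θ S L : ℝ) (f : H → ℝ) : Prop where
  continuous : Continuous f
  abs_le : ∀ x, |f x| ≤ S
  nonneg : 0 ≤ L
  holder : ∀ x y, |f x - f y| ≤ L * ‖x - y‖ ^ θ

/-- The function `(-A)^{1/2} D Pₜ f`, as a Gaussian integral. -/
noncomputable def ouGradient [MeasurableSpace H] (e : HilbertBasis ℕ ℝ H) (lam : ℕ → ℝ) (z : H)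
    (t : ℝ) (f : H → ℝ) (x : H) : H :=
  diagonal e (fun k => √(lam k) * smoothingCoeff lam t k)
    (∫ y, f (semigroup e lam t x + y + drift e lam t z) • y
      ∂gaussianMeasure e (covEigenvalue lam t))

variable [MeasurableSpace H] [CompleteSpace H] [TopologicalSpace.SeparableSpace H] [BorelSpace H]
  {e : HilbertBasis ℕ ℝ H} {ω : ℝ} {lam : ℕ → ℝ} {t : ℝ} {θ S L : ℝ} {f : H → ℝ}

theorem isCenteredGaussian_covEigenvalue (h : IsSpectralSequence ω lam) (ht : 0 < t) :
    IsCenteredGaussian (gaussianMeasure e (covEigenvalue lam t))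
      (diagonal e fun k => (covEigenvalue lam t k : ℝ)) :=
  isCenteredGaussian_gaussianMeasure (summable_covEigenvalue h ht) (covEigenvalue_pos h ht)

theorem inner_ouGradient (h : IsSpectralSequence ω lam) (ht : 0 < t)
    (hf : IsHolderBounded θ S L f) (z x g : H) :
    inner ℝ (ouGradient e lam z t f x) g =
      ∫ y, f (semigroup e lam t x + drift e lam t z + y) *
        inner ℝ (diagonal e (fun k => √(lam k) * smoothingCoeff lam t k) g) y
        ∂gaussianMeasure e (covEigenvalue lam t) := by
  have hsc : SecondCountableTopology H := UniformSpace.secondCountable_of_separable H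
  obtain ⟨C, hC⟩ := exists_smoothingCoeff_le h ht
  have := (isCenteredGaussian_covEigenvalue (e := e) h ht).isGaussian
  have hfc := hf.continuous
  have hi : Integrable (fun y => f (semigroup e lam t x + y + drift e lam t z) • y)
      (gaussianMeasure e (covEigenvalue lam t)) := by
    refine (IsGaussian.integrable_id.norm.const_mul S).mono'
      (Continuous.aestronglyMeasurable (by fun_prop)) (Eventually.of_forall fun y => ?_)
    rw [norm_smul]
    exact mul_le_mul_of_nonneg_right (hf.abs_le _) (norm_nonneg _)
  rw [ouGradient, diagonal_symm fun k => (hC k).2, real_inner_comm, ← integral_inner hi]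
  congr 1 with y
  rw [inner_smul_right, add_right_comm]

theorem ouSemigroup_eq (z x : H) : ouSemigroup e lam z t f x =
    ∫ y, f (semigroup e lam t x + drift e lam t z + y)
      ∂gaussianMeasure e (covEigenvalue lam t) := by
  rw [ouSemigroup]
  congr 1 with y
  rw [add_right_comm]

theorem abs_ouSemigroup_le (hS : ∀ x, |f x| ≤ S) (z x : H) :
    |ouSemigroup e lam z t f x| ≤ S := by
  have h1 := norm_integral_le_of_norm_le_const
    (μ := gaussianMeasure e (covEigenvalue lam t)) (C := S)
    (f := fun y => f (semigroup e lam t x + y + drift e lam t z))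
    (Eventually.of_forall fun y => hS _)
  rw [probReal_univ, mul_one] at h1
  exact h1

theorem norm_le_of_abs_inner_le {v : H} {c : ℝ} (hc : 0 ≤ c) (hv : ∀ g, |inner ℝ v g| ≤ c * ‖g‖) :
    ‖v‖ ≤ c := by
  by_cases h0 : v = 0
  · simpa [h0] using hc
  · have h1 := hv v
    rw [real_inner_self_eq_norm_sq, abs_of_nonneg (sq_nonneg _), sq] at h1
    exact le_of_mul_le_mul_right h1 (norm_pos_iff.2 h0)

theorem sqrt_div_sq_le {a b s : ℝ} (ha : 0 ≤ a) (hs : 0 < s) (h : b ≤ 1 / s * a ^ 2) :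
    √b ≤ s ^ (-(1 / 2) : ℝ) * a := by
  refine Real.sqrt_le_iff.2 ⟨by positivity, h.trans_eq ?_⟩
  rw [mul_pow, ← Real.rpow_natCast (s ^ (-(1 / 2) : ℝ)), ← Real.rpow_mul hs.le]
  norm_num [Real.rpow_neg_one]

theorem sqrt_covariance_smoothing_le (h : IsSpectralSequence ω lam) (ht : 0 < t) (g : H) :
    √(inner ℝ (diagonal e (fun k => (covEigenvalue lam t k : ℝ))
      (diagonal e (smoothingCoeff lam t) g)) (diagonal e (smoothingCoeff lam t) g)) ≤
      t ^ (-(1 / 2) : ℝ) * ‖g‖ := by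
  obtain ⟨C, hC⟩ := exists_smoothingCoeff_le h ht
  exact sqrt_div_sq_le (norm_nonneg g) ht (inner_covariance_diagonal_le h ht (fun k => (hC k).1)
    (covEigenvalue_mul_smoothingCoeff_sq_le h ht) g)

theorem sqrt_covariance_sqrt_smoothing_le (h : IsSpectralSequence ω lam) (ht : 0 < t) (g : H) :
    √(inner ℝ (diagonal e (fun k => (covEigenvalue lam t k : ℝ))
      (diagonal e (fun k => √(lam k) * smoothingCoeff lam t k) g))
        (diagonal e (fun k => √(lam k) * smoothingCoeff lam t k) g)) ≤ t ^ (-1 : ℝ) * ‖g‖ := by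
  obtain ⟨C, hC⟩ := exists_smoothingCoeff_le h ht
  have h1 := inner_covariance_diagonal_le (e := e) h ht (fun k => (hC k).2)
    (lam_mul_covEigenvalue_mul_smoothingCoeff_sq_le h ht) g
  refine Real.sqrt_le_iff.2 ⟨by positivity, h1.trans_eq ?_⟩
  rw [mul_pow, Real.rpow_neg_one]
  simp

/-- The smoothing estimate for `(-A)^{1/2} D Pₜ`. -/
theorem exists_norm_ouGradient_le : ∃ c : ℝ, 0 < c ∧
    ∀ {H : Type*} [NormedAddCommGroup H] [InnerProductSpace ℝ H] [MeasurableSpace H]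
      [CompleteSpace H] [TopologicalSpace.SeparableSpace H] [BorelSpace H]
      {e : HilbertBasis ℕ ℝ H} {ω : ℝ} {lam : ℕ → ℝ} {t θ S L : ℝ} {f : H → ℝ},
      IsSpectralSequence ω lam → 0 < t → 0 ≤ θ → θ ≤ 1 → IsHolderBounded θ S L f → ∀ z x : H,
      ‖ouGradient e lam z t f x‖ ≤ c * L * t ^ (θ / 2 - 1) := by
  obtain ⟨c, hc, H1⟩ := exists_abs_integral_mul_inner_le
  refine ⟨c, hc, ?_⟩
  intro H _ _ _ _ _ _ e ω lam t θ S L f h ht hθ0 hθ1 hf z x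
  have hL := hf.nonneg
  refine norm_le_of_abs_inner_le (by positivity) fun g => ?_
  rw [inner_ouGradient h ht hf]
  refine (H1 (isCenteredGaussian_covEigenvalue h ht) f S L θ t _ _ hθ0 hθ1 ht.le
    (norm_sq_covariance_le h ht) hf.continuous.measurable hf.abs_le hL hf.holder).trans ?_
  calc _ ≤ c * (L * t ^ (θ / 2)) * (t ^ (-1 : ℝ) * ‖g‖) :=
        mul_le_mul_of_nonneg_left (sqrt_covariance_sqrt_smoothing_le h ht g) (by positivity)
    _ = _ := by rw [sub_eq_add_neg, Real.rpow_add ht]; ring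

/-- The Lipschitz estimate for `(-A)^{1/2} D Pₜ f`. -/
theorem exists_norm_ouGradient_sub_le : ∃ c : ℝ, 0 < c ∧
    ∀ {H : Type*} [NormedAddCommGroup H] [InnerProductSpace ℝ H] [MeasurableSpace H]
      [CompleteSpace H] [TopologicalSpace.SeparableSpace H] [BorelSpace H]
      {e : HilbertBasis ℕ ℝ H} {ω : ℝ} {lam : ℕ → ℝ} {t θ S L : ℝ} {f : H → ℝ},
      IsSpectralSequence ω lam → 0 < t → 0 ≤ θ → θ ≤ 1 → IsHolderBounded θ S L f →
      ∀ z x x' : H, ‖ouGradient e lam z t f x - ouGradient e lam z t f x'‖ ≤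
        c * L * ‖x - x'‖ * t ^ (θ / 2 - 3 / 2) := by
  obtain ⟨c, hc, H1⟩ := exists_abs_integral_translate_sub_mul_inner_le
  refine ⟨c, hc, ?_⟩
  intro H _ _ _ _ _ _ e ω lam t θ S L f h ht hθ0 hθ1 hf z x x'
  have hL := hf.nonneg
  refine norm_le_of_abs_inner_le (by positivity) fun g => ?_
  have hx : semigroup e lam t x + drift e lam t z = semigroup e lam t x' + drift e lam t z +
      diagonal e (fun k => (covEigenvalue lam t k : ℝ))
        (diagonal e (smoothingCoeff lam t) (x - x')) := by
    rw [add_right_comm, ← semigroup_add h ht, add_sub_cancel]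
  rw [inner_sub_left, inner_ouGradient h ht hf, inner_ouGradient h ht hf, hx]
  refine (H1 (isCenteredGaussian_covEigenvalue h ht) f S L θ t _ _ _ hθ0 hθ1 ht.le
    (norm_sq_covariance_le h ht) hf.continuous.measurable hf.abs_le hL hf.holder).trans ?_
  -- The three powers come from the Hölder gain, from `(-A)^{1/2} D`, and from the translation by `x
  -- - x'`.
  calc _ ≤ c * (L * t ^ (θ / 2)) * (t ^ (-1 : ℝ) * ‖g‖) *
          (t ^ (-(1 / 2) : ℝ) * ‖x - x'‖) :=
        mul_le_mul (mul_le_mul_of_nonneg_left (sqrt_covariance_sqrt_smoothing_le h ht g)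
          (by positivity)) (sqrt_covariance_smoothing_le h ht _) (Real.sqrt_nonneg _)
          (by positivity)
    _ = _ := by
        rw [show θ / 2 - 3 / 2 = θ / 2 + (-1 + -(1 / 2)) by ring, Real.rpow_add ht,
          Real.rpow_add ht]
        ring

/-- The first order Taylor estimate for `Pₜ f`. -/
theorem exists_abs_ouSemigroup_taylor_le : ∃ c : ℝ, 0 < c ∧
    ∀ {H : Type*} [NormedAddCommGroup H] [InnerProductSpace ℝ H] [MeasurableSpace H]
      [CompleteSpace H] [TopologicalSpace.SeparableSpace H] [BorelSpace H]
      {e : HilbertBasis ℕ ℝ H} {ω : ℝ} {lam : ℕ → ℝ} {t θ S L : ℝ} {f : H → ℝ},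
      IsSpectralSequence ω lam → 0 < t → 0 ≤ θ → θ ≤ 1 → IsHolderBounded θ S L f →
      ∀ z x g : H, |ouSemigroup e lam z t f (x + g) - ouSemigroup e lam z t f x -
        inner ℝ (ouGradient e lam z t f x) (diagonal e (fun k => (√(lam k))⁻¹) g)| ≤
        c * L * ‖g‖ ^ 2 * t ^ (θ / 2 - 1) := by
  obtain ⟨c, hc, H1⟩ := exists_abs_integral_translate_taylor_le
  refine ⟨c, hc, ?_⟩
  intro H _ _ _ _ _ _ e ω lam t θ S L f h ht hθ0 hθ1 hf z x g
  have hL := hf.nonneg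
  obtain ⟨C, hC⟩ := exists_smoothingCoeff_le h ht
  have hν := isCenteredGaussian_covEigenvalue (e := e) h ht
  -- Testing against `(-A)^{-1/2} g` cancels the weight `(-A)^{1/2}`, leaving the vector `w` that
  -- generates the shift `e^{tA} g`.
  have hw : diagonal e (fun k => √(lam k) * smoothingCoeff lam t k)
      (diagonal e (fun k => (√(lam k))⁻¹) g) = diagonal e (smoothingCoeff lam t) g := by
    refine ext_inner_basis e fun k => ?_
    have := (Real.sqrt_pos.2 (h.lam_pos k)).ne'
    rw [inner_diagonal fun k => (hC k).2, inner_diagonal (abs_inv_sqrt_le h),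
      inner_diagonal fun k => (hC k).1]
    field_simp
  have hfm := hf.continuous.measurable
  rw [inner_ouGradient h ht hf, hw, ouSemigroup_eq, ouSemigroup_eq, semigroup_add h ht,
    add_right_comm, ← integral_sub (integrable_shift hfm hf.abs_le _)
      (integrable_shift hfm hf.abs_le _), ← integral_sub]
  · refine (H1 hν f S L θ t _ _ hθ0 hθ1 ht.le
      (norm_sq_covariance_le h ht) hfm hf.abs_le hL hf.holder).trans ?_
    calc _ ≤ c * (L * t ^ (θ / 2)) * (1 / t * ‖g‖ ^ 2) :=
          mul_le_mul_of_nonneg_left (inner_covariance_diagonal_le h ht (fun k => (hC k).1)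
            (covEigenvalue_mul_smoothingCoeff_sq_le h ht) g) (by positivity)
      _ = _ := by rw [sub_eq_add_neg, Real.rpow_add ht, Real.rpow_neg_one]; ring
  · exact (integrable_shift hfm hf.abs_le _).sub (integrable_shift hfm hf.abs_le _)
  · exact hν.integrable_mul_inner hfm hf.abs_le _ _

/-! ### Measurability in time -/

section Measurability

variable (e lam)

theorem measurable_semigroup (x : H) : Measurable fun t => semigroup e lam t x := by
  have : SecondCountableTopology H := UniformSpace.secondCountable_of_separable H
  exact (measurable_gaussianSeries e).comp (measurable_pi_lambda _ fun k => by fun_prop)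

theorem measurable_drift (z : H) : Measurable fun t => drift e lam t z := by
  have : SecondCountableTopology H := UniformSpace.secondCountable_of_separable H
  exact (measurable_gaussianSeries e).comp (measurable_pi_lambda _ fun k => by fun_prop)

theorem measurable_covEigenvalue (k : ℕ) : Measurable fun t => covEigenvalue lam t k := by
  unfold covEigenvalue
  fun_prop

theorem measurable_ouSemigroup (hf : Continuous f) (z x : H) :
    StronglyMeasurable fun t => ouSemigroup e lam z t f x := by
  have hsc : SecondCountableTopology H := UniformSpace.secondCountable_of_separable H
  refine stronglyMeasurable_integral_gaussianMeasure (measurable_covEigenvalue lam)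
    (F := fun t y => f (semigroup e lam t x + y + drift e lam t z)) ?_
  have h1 := measurable_semigroup e lam x
  have h2 := measurable_drift e lam z
  have h3 := hf.measurable
  refine Measurable.stronglyMeasurable ?_
  unfold Function.uncurry
  fun_prop

/-- The definition of `diagonal` gives no direct measurability in `t`; for `t > 0` it agrees with
its coordinate series, which is measurable. -/
theorem aestronglyMeasurable_ouGradient {lam : ℕ → ℝ} (h : IsSpectralSequence ω lam)
    (hf : Continuous f) (z x : H) :
    AEStronglyMeasurable (fun t => ouGradient e lam z t f x) (volume.restrict (Ioi 0)) := by
  have hsc : SecondCountableTopology H := UniformSpace.secondCountable_of_separable H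
  have h1 := measurable_semigroup e lam x
  have h2 := measurable_drift e lam z
  have h3 := hf.measurable
  have h4 : StronglyMeasurable fun t => ∫ y, f (semigroup e lam t x + y + drift e lam t z) • y
      ∂gaussianMeasure e (covEigenvalue lam t) := by
    refine stronglyMeasurable_integral_gaussianMeasure (measurable_covEigenvalue lam)
      (F := fun t y => f (semigroup e lam t x + y + drift e lam t z) • y) ?_
    refine Measurable.stronglyMeasurable ?_
    unfold Function.uncurry
    fun_prop
  have h5 := h4.measurable
  have h6 : Measurable fun t => ∑' k, ((√(lam k) * smoothingCoeff lam t k) * inner ℝ (e k)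
      (∫ y, f (semigroup e lam t x + y + drift e lam t z) • y
        ∂gaussianMeasure e (covEigenvalue lam t))) • e k := by
    refine (measurable_gaussianSeries e).comp (measurable_pi_lambda _ fun k => ?_)
    have h7 := measurable_covEigenvalue lam k
    unfold smoothingCoeff
    fun_prop
  refine h6.aestronglyMeasurable.congr ?_
  filter_upwards [ae_restrict_mem measurableSet_Ioi] with t ht
  obtain ⟨C, hC⟩ := exists_smoothingCoeff_le h ht
  exact (hasSum_diagonal (fun k => (hC k).2) _).tsum_eq

end Measurability

end Kernel

/-! ### Integration over time: the resolvent and its gradient -/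

section Resolvent

theorem integrableOn_exp_mul_rpow {θ r : ℝ} (hθ : 0 < θ) (hr : 0 < r) :
    IntegrableOn (fun t => Real.exp (-r * t) * t ^ (θ / 2 - 1)) (Ioi 0) := by
  have h := integrableOn_rpow_mul_exp_neg_mul_rpow (p := 1) (s := θ / 2 - 1) (b := r)
    (by linarith) one_pos hr
  simpa only [Real.rpow_one, mul_comm] using h

theorem integral_exp_mul_rpow {θ r : ℝ} (hθ : 0 < θ) (hr : 0 < r) :
    ∫ t in Ioi 0, Real.exp (-r * t) * t ^ (θ / 2 - 1) =
      (1 / r) ^ (θ / 2) * Real.Gamma (θ / 2) := by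
  rw [← Real.integral_rpow_mul_exp_neg_mul_Ioi (by positivity) hr]
  congr 1 with t
  rw [mul_comm, neg_mul]

variable {H : Type*} [NormedAddCommGroup H] [InnerProductSpace ℝ H] [MeasurableSpace H]
  [CompleteSpace H] [TopologicalSpace.SeparableSpace H] [BorelSpace H]

/-- The function `(-A)^{1/2} D u⁽ᶻ⁾`, as an integral over time. -/
noncomputable def gradResolvent (e : HilbertBasis ℕ ℝ H) (lam : ℕ → ℝ) (z : H) (r : ℝ)
    (f : H → ℝ) (x : H) : H :=
  ∫ t in Ioi (0 : ℝ), Real.exp (-r * t) • ouGradient e lam z t f x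

variable {e : HilbertBasis ℕ ℝ H} {ω : ℝ} {lam : ℕ → ℝ} {θ S L r : ℝ} {f : H → ℝ}

theorem integrableOn_ouSemigroup (hr : 0 < r) (hf : IsHolderBounded θ S L f) (z x : H) :
    IntegrableOn (fun t => Real.exp (-r * t) * ouSemigroup e lam z t f x) (Ioi 0) := by
  have h1 : IntegrableOn (fun t => S * Real.exp (-r * t)) (Ioi 0) :=
    (integrableOn_exp_mul_Ioi (neg_lt_zero.2 hr) 0).const_mul S
  refine h1.mono' ?_ (Eventually.of_forall fun t => ?_)
  · exact Continuous.aestronglyMeasurable (by fun_prop) |>.mul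
      (measurable_ouSemigroup e lam hf.continuous z x).aestronglyMeasurable
  · rw [norm_mul, Real.norm_of_nonneg (Real.exp_pos _).le, mul_comm]
    exact mul_le_mul_of_nonneg_right (abs_ouSemigroup_le hf.abs_le z x) (Real.exp_pos _).le

theorem abs_ouResolvent_le (hr : 0 < r) (hf : IsHolderBounded θ S L f) (z x : H) :
    |ouResolvent e lam z r f x| ≤ ∫ t in Ioi (0 : ℝ), S * Real.exp (-r * t) := by
  have h1 : IntegrableOn (fun t => S * Real.exp (-r * t)) (Ioi 0) :=
    (integrableOn_exp_mul_Ioi (neg_lt_zero.2 hr) 0).const_mul S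
  rw [ouResolvent, ← Real.norm_eq_abs]
  refine norm_integral_le_of_norm_le h1 (Eventually.of_forall fun t => ?_)
  rw [norm_mul, Real.norm_of_nonneg (Real.exp_pos _).le, mul_comm]
  exact mul_le_mul_of_nonneg_right (abs_ouSemigroup_le hf.abs_le z x) (Real.exp_pos _).le

theorem integrableOn_ouGradient (h : IsSpectralSequence ω lam) (hθ0 : 0 < θ) (hθ1 : θ ≤ 1)
    (hr : 0 < r) (hf : IsHolderBounded θ S L f) (z x : H) :
    IntegrableOn (fun t => Real.exp (-r * t) • ouGradient e lam z t f x) (Ioi 0) := by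
  obtain ⟨c, hc, H1⟩ := exists_norm_ouGradient_le
  refine ((integrableOn_exp_mul_rpow hθ0 hr).const_mul (c * L)).mono' ?_ ?_
  · exact Continuous.aestronglyMeasurable (by fun_prop) |>.smul
      (aestronglyMeasurable_ouGradient e h hf.continuous z x)
  · filter_upwards [ae_restrict_mem measurableSet_Ioi] with t ht
    rw [norm_smul, Real.norm_of_nonneg (Real.exp_pos _).le]
    have := mul_le_mul_of_nonneg_left (H1 (e := e) h ht hθ0.le hθ1 hf z x)
      (Real.exp_pos (-r * t)).le
    linarith

theorem inner_gradResolvent (h : IsSpectralSequence ω lam) (hθ0 : 0 < θ) (hθ1 : θ ≤ 1)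
    (hr : 0 < r) (hf : IsHolderBounded θ S L f) (z x g : H) :
    inner ℝ (gradResolvent e lam z r f x) g =
      ∫ t in Ioi (0 : ℝ), Real.exp (-r * t) * inner ℝ (ouGradient e lam z t f x) g := by
  rw [gradResolvent, real_inner_comm, ← integral_inner (integrableOn_ouGradient h hθ0 hθ1 hr hf z x)]
  congr 1 with t
  rw [inner_smul_right, real_inner_comm]

/-- The supremum estimate for `(-A)^{1/2} D u⁽ᶻ⁾`. -/
theorem exists_norm_gradResolvent_le : ∃ c : ℝ, 0 < c ∧
    ∀ {H : Type*} [NormedAddCommGroup H] [InnerProductSpace ℝ H] [MeasurableSpace H]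
      [CompleteSpace H] [TopologicalSpace.SeparableSpace H] [BorelSpace H]
      {e : HilbertBasis ℕ ℝ H} {ω : ℝ} {lam : ℕ → ℝ} {θ S L r : ℝ} {f : H → ℝ},
      IsSpectralSequence ω lam → 0 < θ → θ ≤ 1 → 0 < r → IsHolderBounded θ S L f →
      ∀ z x : H, ‖gradResolvent e lam z r f x‖ ≤
        c * L * ((1 / r) ^ (θ / 2) * Real.Gamma (θ / 2)) := by
  obtain ⟨c, hc, H1⟩ := exists_norm_ouGradient_le
  refine ⟨c, hc, ?_⟩
  intro H _ _ _ _ _ _ e ω lam θ S L r f h hθ0 hθ1 hr hf z x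
  rw [← integral_exp_mul_rpow hθ0 hr, ← integral_const_mul]
  refine norm_integral_le_of_norm_le ((integrableOn_exp_mul_rpow hθ0 hr).const_mul (c * L)) ?_
  filter_upwards [ae_restrict_mem measurableSet_Ioi] with t ht
  rw [norm_smul, Real.norm_of_nonneg (Real.exp_pos _).le]
  have := mul_le_mul_of_nonneg_left (H1 (e := e) h ht hθ0.le hθ1 hf z x)
    (Real.exp_pos (-r * t)).le
  linarith

/-- The Hölder estimate for `(-A)^{1/2} D u⁽ᶻ⁾`. -/
theorem exists_norm_gradResolvent_sub_le {θ : ℝ} (hθ0 : 0 < θ) (hθ1 : θ < 1) : ∃ c : ℝ, 0 < c ∧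
    ∀ {H : Type*} [NormedAddCommGroup H] [InnerProductSpace ℝ H] [MeasurableSpace H]
      [CompleteSpace H] [TopologicalSpace.SeparableSpace H] [BorelSpace H]
      {e : HilbertBasis ℕ ℝ H} {ω : ℝ} {lam : ℕ → ℝ} {S L r : ℝ} {f : H → ℝ},
      IsSpectralSequence ω lam → 0 < r → IsHolderBounded θ S L f →
      ∀ z x x' : H, ‖gradResolvent e lam z r f x - gradResolvent e lam z r f x'‖ ≤
        c * L * ‖x - x'‖ ^ θ := by
  obtain ⟨c, hc, H1⟩ := exists_norm_ouGradient_le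
  obtain ⟨c', hc', H2⟩ := exists_norm_ouGradient_sub_le
  have hθ2 : 0 < 1 - θ := by linarith
  refine ⟨2 * c * (2 / θ) + c' * (2 / (1 - θ)), by positivity, ?_⟩
  intro H _ _ _ _ _ _ e ω lam S L r f h hr hf z x x'
  have hL := hf.nonneg
  rcases eq_or_ne x x' with rfl | hne
  · simp [Real.zero_rpow hθ0.ne']
  set a := ‖x - x'‖ with ha
  have ha0 : 0 < a := norm_pos_iff.2 (sub_ne_zero.2 hne)
  have ha2 : 0 < a ^ 2 := by positivity
  have i1 := integrableOn_ouGradient (e := e) h hθ0 hθ1.le hr hf z x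
  have i2 := integrableOn_ouGradient (e := e) h hθ0 hθ1.le hr hf z x'
  have hexp : ∀ {t : ℝ}, 0 < t → Real.exp (-r * t) ≤ 1 := fun ht => by
    rw [Real.exp_le_one_iff]; nlinarith
  rw [gradResolvent, gradResolvent, ← integral_sub i1 i2]
  set F : ℝ → H := fun t => Real.exp (-r * t) • ouGradient e lam z t f x -
    Real.exp (-r * t) • ouGradient e lam z t f x' with hF
  have i3 : IntegrableOn F (Ioi 0) := i1.sub i2
  -- Split at `t = |x - x'|²`, where the two bounds balance: twice the supremum bound on the short
  -- interval, the Lipschitz bound on the tail. Each piece is of order `|x - x'|^θ`.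
  rw [← Ioc_union_Ioi_eq_Ioi ha2.le, setIntegral_union (Ioc_disjoint_Ioi le_rfl) measurableSet_Ioi
    (i3.mono_set Ioc_subset_Ioi_self) (i3.mono_set (Ioi_subset_Ioi ha2.le))]
  have b1 : ‖∫ t in Ioc 0 (a ^ 2), F t‖ ≤ 2 * c * L * (2 / θ * a ^ θ) := by
    have j1 : IntegrableOn (fun t : ℝ => t ^ (θ / 2 - 1)) (Ioc 0 (a ^ 2)) :=
      (intervalIntegrable_iff_integrableOn_Ioc_of_le ha2.le).1
        (intervalIntegral.intervalIntegrable_rpow' (by linarith))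
    have j2 : ∫ t in Ioc 0 (a ^ 2), t ^ (θ / 2 - 1) = 2 / θ * a ^ θ := by
      rw [← intervalIntegral.integral_of_le ha2.le, integral_rpow (Or.inl (by linarith)),
        sub_add_cancel, Real.zero_rpow (by positivity), ← Real.rpow_natCast, ← Real.rpow_mul ha0.le]
      rw [show ((2 : ℕ) : ℝ) * (θ / 2) = θ by push_cast; ring]
      field_simp
      ring
    rw [← j2, ← integral_const_mul]
    refine norm_integral_le_of_norm_le (j1.const_mul _) ?_
    filter_upwards [ae_restrict_mem measurableSet_Ioc] with t ht
    rw [hF]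
    dsimp only
    rw [← smul_sub, norm_smul, Real.norm_of_nonneg (Real.exp_pos _).le]
    have k1 := H1 (e := e) h ht.1 hθ0.le hθ1.le hf z x
    have k2 := H1 (e := e) h ht.1 hθ0.le hθ1.le hf z x'
    have k3 := norm_sub_le (ouGradient e lam z t f x) (ouGradient e lam z t f x')
    refine (mul_le_of_le_one_left (norm_nonneg _) (hexp ht.1)).trans ?_
    linarith
  have b2 : ‖∫ t in Ioi (a ^ 2), F t‖ ≤ c' * L * a * (2 / (1 - θ) * a ^ (θ - 1)) := by
    have j1 : IntegrableOn (fun t : ℝ => t ^ (θ / 2 - 3 / 2)) (Ioi (a ^ 2)) :=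
      integrableOn_Ioi_rpow_of_lt (by linarith) ha2
    have j2 : ∫ t in Ioi (a ^ 2), t ^ (θ / 2 - 3 / 2) = 2 / (1 - θ) * a ^ (θ - 1) := by
      rw [integral_Ioi_rpow_of_lt (by linarith) ha2, ← Real.rpow_natCast, ← Real.rpow_mul ha0.le]
      rw [show ((2 : ℕ) : ℝ) * (θ / 2 - 3 / 2 + 1) = θ - 1 by push_cast; ring,
        show θ / 2 - 3 / 2 + 1 = -((1 - θ) / 2) by ring]
      field_simp
    rw [← j2, ← integral_const_mul]
    refine norm_integral_le_of_norm_le (j1.const_mul _) ?_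
    filter_upwards [ae_restrict_mem measurableSet_Ioi] with t ht
    have ht0 : 0 < t := ha2.trans ht
    rw [hF]
    dsimp only
    rw [← smul_sub, norm_smul, Real.norm_of_nonneg (Real.exp_pos _).le]
    exact (mul_le_of_le_one_left (norm_nonneg _) (hexp ht0)).trans
      (H2 (e := e) h ht0 hθ0.le hθ1.le hf z x x')
  have haθ : a * a ^ (θ - 1) = a ^ θ := by
    rw [Real.rpow_sub_one ha0.ne']; field_simp
  refine (norm_add_le _ _).trans ((add_le_add b1 b2).trans_eq ?_)
  rw [← haθ]
  ring

/-- The Taylor remainder of `Pₜ f` is quadratic in the increment with a coefficient integrable in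
time, so integrating it gives differentiability without differentiating under the integral sign. -/
theorem hasGradientAt_ouResolvent (h : IsSpectralSequence ω lam) (hθ0 : 0 < θ) (hθ1 : θ ≤ 1)
    (hr : 0 < r) (hf : IsHolderBounded θ S L f) (z x : H) :
    HasGradientAt (ouResolvent e lam z r f)
      (diagonal e (fun k => (√(lam k))⁻¹) (gradResolvent e lam z r f x)) x := by
  obtain ⟨c, hc, H1⟩ := exists_abs_ouSemigroup_taylor_le
  rw [hasGradientAt_iff_hasFDerivAt, hasFDerivAt_iff_isLittleO_nhds_zero]
  refine Asymptotics.IsBigO.trans_isLittleO (g := fun g : H => ‖g‖ ^ 2) ?_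
    (Asymptotics.isLittleO_norm_pow_id one_lt_two)
  refine Asymptotics.IsBigO.of_bound (c * L * ((1 / r) ^ (θ / 2) * Real.Gamma (θ / 2)))
    (Eventually.of_forall fun g => ?_)
  rw [InnerProductSpace.toDual_apply_apply, diagonal_symm (abs_inv_sqrt_le h),
    inner_gradResolvent h hθ0 hθ1 hr hf]
  have i1 := integrableOn_ouSemigroup (e := e) (lam := lam) hr hf z (x + g)
  have i2 := integrableOn_ouSemigroup (e := e) (lam := lam) hr hf z x
  have i3 : IntegrableOn (fun t => Real.exp (-r * t) * inner ℝ (ouGradient e lam z t f x)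
      (diagonal e (fun k => (√(lam k))⁻¹) g)) (Ioi 0) := by
    refine ((integrableOn_ouGradient (e := e) h hθ0 hθ1 hr hf z x).inner_const
      (𝕜 := ℝ) (diagonal e (fun k => (√(lam k))⁻¹) g)).congr ?_
    exact Eventually.of_forall fun t => by simp [inner_smul_left]
  rw [ouResolvent, ouResolvent, ← integral_sub i1 i2, ← integral_sub (by exact i1.sub i2) i3,
    ← integral_exp_mul_rpow hθ0 hr, norm_pow, norm_norm, mul_right_comm, ← integral_const_mul]
  refine norm_integral_le_of_norm_le ((integrableOn_exp_mul_rpow hθ0 hr).const_mul _) ?_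
  filter_upwards [ae_restrict_mem measurableSet_Ioi] with t ht
  rw [← mul_sub, ← mul_sub, norm_mul, Real.norm_of_nonneg (Real.exp_pos _).le]
  have := mul_le_mul_of_nonneg_left (H1 (e := e) h ht hθ0.le hθ1 hf z x g)
    (Real.exp_pos (-r * t)).le
  rw [← Real.norm_eq_abs] at this
  linarith

theorem isSqrtNegGradient_gradResolvent (h : IsSpectralSequence ω lam) (hθ0 : 0 < θ)
    (hθ1 : θ ≤ 1) (hr : 0 < r) (hf : IsHolderBounded θ S L f) (z : H) :
    IsSqrtNegGradient e lam (ouResolvent e lam z r f) (gradResolvent e lam z r f) := by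
  intro x
  have hg := (hasGradientAt_ouResolvent (e := e) h hθ0 hθ1 hr hf z x).gradient
  have hk : ∀ k, √(lam k) * inner ℝ (e k) (gradient (ouResolvent e lam z r f) x) =
      inner ℝ (e k) (gradResolvent e lam z r f x) := by
    intro k
    have := (Real.sqrt_pos.2 (h.lam_pos k)).ne'
    rw [hg, inner_diagonal (abs_inv_sqrt_le h)]
    field_simp
  have hmem : gradient (ouResolvent e lam z r f) x ∈ (sqrtNeg e lam).domain := by
    change Memℓp _ 2
    simp_rw [hk, ← e.repr_apply_apply]
    exact lp.memℓp _
  refine ⟨hmem, ext_inner_basis e fun k => ?_⟩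
  rw [← hk, ← e.repr_apply_apply (sqrtNeg e lam ⟨_, hmem⟩)]
  change _ = e.repr (e.repr.symm _) k
  rw [LinearIsometryEquiv.apply_symm_apply]

/-- The gradient is the bounded operator `(-A)^{-1/2}`, of norm at most `ω^{-1/2}`, applied to a
bounded Hölder map. -/
theorem isCbOne_ouResolvent (h : IsSpectralSequence ω lam) (hθ0 : 0 < θ) (hθ1 : θ < 1)
    (hr : 0 < r) (hf : IsHolderBounded θ S L f) (z : H) :
    IsCbOne (ouResolvent e lam z r f) := by
  obtain ⟨c, hc, H1⟩ := exists_norm_gradResolvent_le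
  obtain ⟨c', hc', H2⟩ := exists_norm_gradResolvent_sub_le hθ0 hθ1
  have hfd : ∀ x, HasFDerivAt (ouResolvent e lam z r f) (InnerProductSpace.toDual ℝ H
      (diagonal e (fun k => (√(lam k))⁻¹) (gradResolvent e lam z r f x))) x := fun x =>
    (hasGradientAt_ouResolvent h hθ0 hθ1.le hr hf z x).hasFDerivAt
  have hfd' : fderiv ℝ (ouResolvent e lam z r f) = fun x => InnerProductSpace.toDual ℝ H
      (diagonal e (fun k => (√(lam k))⁻¹) (gradResolvent e lam z r f x)) :=
    funext fun x => (hfd x).fderiv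
  have hcont : Continuous (gradResolvent e lam z r f) := by
    refine continuous_iff_continuousAt.2 fun x => ?_
    refine tendsto_iff_norm_sub_tendsto_zero.2 ?_
    refine squeeze_zero (fun _ => norm_nonneg _) (fun y => H2 h hr hf z y x) ?_
    have h3 : ContinuousAt (fun y : H => c' * L * ‖y - x‖ ^ θ) x := by
      refine ContinuousAt.mul continuousAt_const (ContinuousAt.rpow_const (by fun_prop)
        (Or.inr hθ0.le))
    have h4 := h3.tendsto
    simpa [Real.zero_rpow hθ0.ne'] using h4
  refine ⟨contDiff_one_iff_fderiv.2 ⟨fun x => (hfd x).differentiableAt, ?_⟩, ?_, ?_⟩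
  · rw [hfd']
    fun_prop
  · refine lt_of_le_of_lt (iSup_le fun x => ?_)
      (ENNReal.ofReal_lt_top (r := ∫ t in Ioi (0 : ℝ), S * Real.exp (-r * t)))
    rw [← ofReal_norm]
    exact ENNReal.ofReal_le_ofReal (abs_ouResolvent_le hr hf z x)
  · refine lt_of_le_of_lt (iSup_le fun x => ?_) (ENNReal.ofReal_lt_top
      (r := (√ω)⁻¹ * (c * L * ((1 / r) ^ (θ / 2) * Real.Gamma (θ / 2)))))
    rw [← ofReal_norm, hfd', LinearIsometryEquiv.norm_map]
    exact ENNReal.ofReal_le_ofReal ((norm_diagonal_le (abs_inv_sqrt_le h) _).trans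
      (mul_le_mul_of_nonneg_left (H1 h hθ0 hθ1.le hr hf z x) (by positivity)))

theorem tsum_rpow_eq_enorm_gradResolvent (h : IsSpectralSequence ω lam) (hθ0 : 0 < θ)
    (hθ1 : θ ≤ 1) (hr : 0 < r) (hf : IsHolderBounded θ S L f) (z x : H) :
    (∑' k, ENNReal.ofReal (lam k * (lineDeriv ℝ (ouResolvent e lam z r f) x (e k)) ^ 2)) ^
      (1 / 2 : ℝ) = ‖gradResolvent e lam z r f x‖ₑ := by
  have hfd := (hasGradientAt_ouResolvent (e := e) h hθ0 hθ1 hr hf z x).hasFDerivAt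
  have hk : ∀ k, lam k * (lineDeriv ℝ (ouResolvent e lam z r f) x (e k)) ^ 2 =
      inner ℝ (e k) (gradResolvent e lam z r f x) ^ 2 := by
    intro k
    have hpos := h.lam_pos k
    rw [hfd.differentiableAt.lineDeriv_eq_fderiv, hfd.fderiv,
      InnerProductSpace.toDual_apply_apply, real_inner_comm, inner_diagonal (abs_inv_sqrt_le h),
      mul_pow, inv_pow, Real.sq_sqrt hpos.le]
    field_simp
  have hs := hasSum_inner_sq e (gradResolvent e lam z r f x)
  simp_rw [hk]
  rw [← ENNReal.ofReal_tsum_of_nonneg (fun _ => sq_nonneg _) hs.summable, hs.tsum_eq,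
    ENNReal.ofReal_rpow_of_nonneg (sq_nonneg _) (by norm_num), ← Real.sqrt_eq_rpow,
    Real.sqrt_sq (norm_nonneg _), ofReal_norm]

/-- Dominated convergence twice: the time integrands are dominated by the smoothing estimate with
the common constant `L`, the Gaussian ones by `S |⟨w, y⟩|`. -/
theorem tendsto_inner_gradResolvent (h : IsSpectralSequence ω lam) (hθ0 : 0 < θ) (hθ1 : θ ≤ 1)
    (hr : 0 < r) (hf : IsHolderBounded θ S L f) {fn : ℕ → H → ℝ}
    (hfn : ∀ n, IsHolderBounded θ S L (fn n))
    (hlim : ∀ x, Tendsto (fun n => fn n x) atTop (𝓝 (f x))) (z x g : H) :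
    Tendsto (fun n => inner ℝ (gradResolvent e lam z r (fn n) x) g) atTop
      (𝓝 (inner ℝ (gradResolvent e lam z r f x) g)) := by
  obtain ⟨c, hc, H1⟩ := exists_norm_ouGradient_le
  rw [inner_gradResolvent h hθ0 hθ1 hr hf]
  simp_rw [fun n => inner_gradResolvent (e := e) h hθ0 hθ1 hr (hfn n) z x g]
  refine tendsto_integral_of_dominated_convergence
    (fun t => c * L * ‖g‖ * (Real.exp (-r * t) * t ^ (θ / 2 - 1))) (fun n => ?_)
    ((integrableOn_exp_mul_rpow hθ0 hr).const_mul _) (fun n => ?_) ?_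
  · exact Continuous.aestronglyMeasurable (by fun_prop) |>.mul
      ((aestronglyMeasurable_ouGradient e h (hfn n).continuous z x).inner_const)
  · filter_upwards [ae_restrict_mem measurableSet_Ioi] with t ht
    rw [norm_mul, Real.norm_of_nonneg (Real.exp_pos _).le]
    have h1 := (norm_inner_le_norm (𝕜 := ℝ) (ouGradient e lam z t (fn n) x) g).trans
      (mul_le_mul_of_nonneg_right (H1 (e := e) h ht hθ0.le hθ1 (hfn n) z x) (norm_nonneg g))
    have := mul_le_mul_of_nonneg_left h1 (Real.exp_pos (-r * t)).le
    linarith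
  · filter_upwards [ae_restrict_mem measurableSet_Ioi] with t ht
    refine Tendsto.const_mul _ ?_
    rw [inner_ouGradient h ht hf]
    simp_rw [fun n => inner_ouGradient (e := e) h ht (hfn n) z x g]
    have hν := isCenteredGaussian_covEigenvalue (e := e) h ht
    refine tendsto_integral_of_dominated_convergence
      (fun y => S * ‖(inner ℝ (diagonal e (fun k => √(lam k) * smoothingCoeff lam t k) g) y : ℝ)‖)
      (fun n => ?_) ((hν.integrable_inner _).norm.const_mul _)
      (fun n => Eventually.of_forall fun y => ?_) (Eventually.of_forall fun y => ?_)
    · exact (hν.integrable_mul_inner (hfn n).continuous.measurable (hfn n).abs_le _ _).1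
    · rw [norm_mul]
      exact mul_le_mul_of_nonneg_right ((hfn n).abs_le _) (norm_nonneg _)
    · exact (hlim _).mul_const _

end Resolvent

/-! ### Passing between extended-valued norms and real bounds -/

section HolderNorm

variable {H : Type*} [NormedAddCommGroup H] {θ : ℝ≥0}

theorem isHolderBounded_of_holderNorm_le [InnerProductSpace ℝ H] (hθ : 0 < θ) {f : H → ℝ}
    {K : ℝ≥0∞} (hf : holderNorm θ f ≤ K) (hK : K ≠ ∞) :
    IsHolderBounded θ K.toReal K.toReal f := by
  have h1 : supNorm f ≤ K := (le_add_right le_rfl).trans hf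
  have h2 : eHolderNorm θ f ≤ K := (le_add_left le_rfl).trans hf
  have h3 : MemHolder θ f := eHolderNorm_lt_top.1 (h2.trans_lt hK.lt_top)
  refine ⟨h3.holderWith.continuous hθ, fun x => ?_, ENNReal.toReal_nonneg, fun x y => ?_⟩
  · have h4 : ‖f x‖ₑ ≤ K := (le_iSup (fun x => ‖f x‖ₑ) x).trans h1
    have h5 := ENNReal.toReal_mono hK h4
    rwa [toReal_enorm, Real.norm_eq_abs] at h5
  · have h4 := h3.holderWith.dist_le x y
    rw [Real.dist_eq, dist_eq_norm] at h4
    refine h4.trans ?_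
    gcongr
    exact ENNReal.toReal_mono hK h2

variable {E : Type*} [NormedAddCommGroup E]

theorem supNorm_le_of_norm_le {G : H → E} {C : ℝ≥0} {K : ℝ≥0∞} (hK : K ≠ ∞)
    (hG : ∀ x, ‖G x‖ ≤ C * K.toReal) : supNorm G ≤ C * K := by
  refine iSup_le fun x => ?_
  rw [← ofReal_norm]
  refine (ENNReal.ofReal_le_ofReal (hG x)).trans_eq ?_
  rw [ENNReal.ofReal_mul C.coe_nonneg, ENNReal.ofReal_toReal hK, ENNReal.ofReal_coe_nnreal]

theorem eHolderNorm_le_of_norm_le {G : H → E} {C : ℝ≥0} {K : ℝ≥0∞} (hK : K ≠ ∞)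
    (hG : ∀ x y, ‖G x - G y‖ ≤ C * K.toReal * ‖x - y‖ ^ (θ : ℝ)) :
    eHolderNorm θ G ≤ C * K := by
  have h1 : HolderWith (C * K.toNNReal) θ G := by
    intro x y
    rw [edist_dist, edist_dist, dist_eq_norm, dist_eq_norm,
      ENNReal.ofReal_rpow_of_nonneg (norm_nonneg _) θ.coe_nonneg]
    refine (ENNReal.ofReal_le_ofReal (hG x y)).trans_eq ?_
    rw [ENNReal.ofReal_mul (by positivity), ENNReal.ofReal_mul C.coe_nonneg, ENNReal.ofReal_toReal hK,
      ENNReal.ofReal_coe_nnreal, ENNReal.coe_mul, ENNReal.coe_toNNReal hK]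
  refine h1.eHolderNorm_le.trans_eq ?_
  rw [ENNReal.coe_mul, ENNReal.coe_toNNReal hK]

end HolderNorm

theorem strictAntiOn_toNNReal_rpow {c s : ℝ} (hc : 0 < c) (hs : 0 < s) :
    StrictAntiOn (fun r : ℝ => (c * (1 / r) ^ s).toNNReal) (Ioi 0) := by
  intro a ha b hb hab
  have ha' : (0 : ℝ) < a := ha
  have hb' : (0 : ℝ) < b := hb
  refine (Real.toNNReal_lt_toNNReal_iff (by positivity)).2 ?_
  gcongr

theorem tendsto_toNNReal_rpow {c s : ℝ} (hs : 0 < s) :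
    Tendsto (fun r : ℝ => (c * (1 / r) ^ s).toNNReal) atTop (𝓝 0) := by
  have h1 : Tendsto (fun r : ℝ => (1 / r) ^ s) atTop (𝓝 0) := by
    have h2 : Tendsto (fun r : ℝ => 1 / r) atTop (𝓝 0) := by
      simpa using tendsto_inv_atTop_zero (𝕜 := ℝ)
    simpa [Real.zero_rpow hs.ne'] using h2.rpow_const (p := s) (Or.inr hs.le)
  have h3 := (continuous_real_toNNReal.tendsto _).comp (h1.const_mul c)
  simpa [Function.comp_def] using h3

end OrnsteinUhlenbeck

/-! ### The theorem -/

theorem theorem3p1 {H : Type*} [NormedAddCommGroup H] [InnerProductSpace ℝ H] [CompleteSpace H]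
    [TopologicalSpace.SeparableSpace H] [MeasurableSpace H] [BorelSpace H]
    (θ : ℝ≥0) (hθ0 : 0 < θ) (hθ1 : θ < 1) :
    -- `C r` is the constant `C_θ(r)` and `M` is the constant `M_θ`
    ∃ (C : ℝ → ℝ≥0) (M : ℝ≥0), StrictAntiOn C (Ioi 0) ∧ Tendsto C atTop (𝓝 0) ∧ 0 < M ∧
      ∀ (A : H →ₗ.[ℝ] H) (e : HilbertBasis ℕ ℝ H) (lam : ℕ → ℝ),
        IsAdmissible A → IsEigenbasis A e lam →
        ∀ (r : ℝ) (z : H), 0 < r →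
          -- (i)
          (∀ f : H → ℝ, IsCbHolder θ f →
            (∀ x, IntegrableOn
              (fun t => Real.exp (-r * t) * ouSemigroup e lam z t f x) (Ioi 0)) ∧
            IsCbOne (ouResolvent e lam z r f) ∧
            ∃ G : H → H, IsSqrtNegGradient e lam (ouResolvent e lam z r f) G ∧
              IsCbHolder θ G ∧
              (⨆ x, (∑' k, ENNReal.ofReal
                (lam k * (lineDeriv ℝ (ouResolvent e lam z r f) x (e k)) ^ 2)) ^ (1 / 2 : ℝ)) =
                supNorm G ∧
              supNorm G ≤ C r * holderNorm θ f ∧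
              eHolderNorm θ G ≤ M * holderNorm θ f) ∧
          -- (ii)
          (∀ (f : H → ℝ) (fn : ℕ → H → ℝ), IsCbHolder θ f → (∀ n, IsCbHolder θ (fn n)) →
            (⨆ n, holderNorm θ (fn n)) < ∞ →
            (∀ x, Tendsto (fun n => fn n x) atTop (𝓝 (f x))) →
            ∃ (G : H → H) (Gn : ℕ → H → H),
              IsSqrtNegGradient e lam (ouResolvent e lam z r f) G ∧
              (∀ n, IsSqrtNegGradient e lam (ouResolvent e lam z r (fn n)) (Gn n)) ∧
              ∀ x h : H, Tendsto (fun n => inner ℝ (Gn n x) h) atTop (𝓝 (inner ℝ (G x) h))) := by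
  have hθ0' : (0 : ℝ) < θ := hθ0
  have hθ1' : (θ : ℝ) < 1 := hθ1
  obtain ⟨c, hc, H1⟩ := exists_norm_gradResolvent_le
  obtain ⟨M, hM, H2⟩ := exists_norm_gradResolvent_sub_le hθ0' hθ1'
  have hΓ : 0 < Real.Gamma (θ / 2) := Real.Gamma_pos_of_pos (by positivity)
  -- `C_θ(r) = c Γ(θ/2) r^{-θ/2}`, from the Laplace transform of `t^{θ/2 - 1}`.
  refine ⟨fun r => (c * Real.Gamma (θ / 2) * (1 / r) ^ ((θ : ℝ) / 2)).toNNReal, M.toNNReal,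
    strictAntiOn_toNNReal_rpow (by positivity) (by positivity),
    tendsto_toNNReal_rpow (by positivity), Real.toNNReal_pos.2 hM, ?_⟩
  intro A e lam hA he r z hr
  obtain ⟨ω, h⟩ := hA.isSpectralSequence he
  constructor
  · intro f hf
    have hK : holderNorm θ f ≠ ∞ := ne_of_lt hf
    have hB := isHolderBounded_of_holderNorm_le hθ0 le_rfl hK
    have hsup : supNorm (gradResolvent e lam z r f) ≤
        (c * Real.Gamma (θ / 2) * (1 / r) ^ ((θ : ℝ) / 2)).toNNReal * holderNorm θ f := by
      refine supNorm_le_of_norm_le hK fun x => ?_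
      rw [Real.coe_toNNReal _ (by positivity)]
      exact (H1 h hθ0' hθ1'.le hr hB z x).trans_eq (by ring)
    have hhol : eHolderNorm θ (gradResolvent e lam z r f) ≤ M.toNNReal * holderNorm θ f := by
      refine eHolderNorm_le_of_norm_le hK fun x y => ?_
      rw [Real.coe_toNNReal _ hM.le]
      exact H2 h hr hB z x y
    refine ⟨fun x => integrableOn_ouSemigroup hr hB z x,
      isCbOne_ouResolvent h hθ0' hθ1' hr hB z, gradResolvent e lam z r f,
      isSqrtNegGradient_gradResolvent h hθ0' hθ1'.le hr hB z, ?_, ?_, hsup, hhol⟩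
    · exact ENNReal.add_lt_top.2
        ⟨hsup.trans_lt (ENNReal.mul_lt_top ENNReal.coe_lt_top hK.lt_top),
          hhol.trans_lt (ENNReal.mul_lt_top ENNReal.coe_lt_top hK.lt_top)⟩
    · exact iSup_congr fun x => tsum_rpow_eq_enorm_gradResolvent h hθ0' hθ1'.le hr hB z x
  · intro f fn hf _ hsup hlim
    -- A single bound for `f` and all `fn`, so that one dominating function serves the whole
    -- sequence.
    have hK : max (holderNorm θ f) (⨆ n, holderNorm θ (fn n)) ≠ ∞ := (max_lt hf hsup).ne
    have hB := isHolderBounded_of_holderNorm_le hθ0 (le_max_left _ _) hK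
    have hBn : ∀ n, IsHolderBounded θ _ _ (fn n) := fun n => isHolderBounded_of_holderNorm_le hθ0
      ((le_iSup (fun n => holderNorm θ (fn n)) n).trans (le_max_right _ _)) hK
    exact ⟨gradResolvent e lam z r f, fun n => gradResolvent e lam z r (fn n),
      isSqrtNegGradient_gradResolvent h hθ0' hθ1'.le hr hB z,
      fun n => isSqrtNegGradient_gradResolvent h hθ0' hθ1'.le hr (hBn n) z,
      fun x g => tendsto_inner_gradResolvent h hθ0' hθ1'.le hr hB hBn hlim z x g⟩
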